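/- On $\mathbb R^3$, with points $\xi=(x,y,t)$, consider the Heisenberg group law $(x_0,y_0,t_0)\circ(x,y,t)=(x_0+x,\,y_0+y,\,t_0+t+2(xy_0-yx_0))$, for which $\xi^{-1}=-\xi$, the gauge $\rho(x,y,t)=\left((x^2+y^2)^2+t^2\right)^{1/4}$, the distance $d(\xi,\xi_0)=\rho(\xi_0^{-1}\circ\xi)$, and the balls $B_R(\xi_0)=\{\xi\in\mathbb R^3: d(\xi,\xi_0)<R\}$. Let $X=\partial_x+2y\,\partial_t$, $Y=\partial_y-2x\,\partial_t$, and for a real-valued function $f$ of class $C^2$ put $$\mathcal H(f)=\begin{pmatrix} X^2f & (XYf+YXf)/2\\ (XYf+YXf)/2 & Y^2f\end{pmatrix}.$$ A function $f\in C^2(\Omega)$, $\Omega\subset\mathbb R^3$ open, is called $\mathcal H$-convex in $\Omega$ if $\mathcal H(f)$ is positive semidefinite at every point of $\Omega$. **Theorem.** Let $\xi_0\in\mathbb R^3$ and $R>0$, and let $\Omega=\{\xi\in\mathbb R^3: 0<d(\xi,\xi_0)<R\}$. Let $v\in C^2(\overline{B_R(\xi_0)})$ be real-valued and $\mathcal H$-convex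 in $\Omega$, with $v=0$ on $\partial B_R(\xi_0)$, and set $$u(\xi)=-v(\xi_0)\left(\frac{d(\xi,\xi_0)}{R}-1\right).$$ Then $\det\mathcal H(u)+12\,(\partial_t u)^2$ and $\det\mathcal H(v)+12\,(\partial_t v)^2$ are Lebesgue integrable on $B_R(\xi_0)$, and $$\int_{B_R(\xi_0)}\left\{\det\mathcal H(u)+12\,(\partial_t u)^2\right\}d\xi\;\le\;\int_{B_R(\xi_0)}\left\{\det\mathcal H(v)+12\,(\partial_t v)^2\right\}d\xi .$$ (The integrand on the left is defined on $B_R(\xi_0)\setminus\{\xi_0\}$.) -/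

import Mathlib

open MeasureTheory

noncomputable section

namespace Heisenberg

/-- The underlying space `ℝ³` of the first Heisenberg group, with points `ξ = (x, y, t)`,
its usual topology and smooth structure, and Lebesgue measure. -/
abbrev H1 : Type := ℝ × ℝ × ℝ

/-- The group law
`(x₀, y₀, t₀) ∘ (x, y, t) = (x₀ + x, y₀ + y, t₀ + t + 2 (x y₀ - y x₀))`;
the inverse of `ξ` for it is `-ξ`. -/
def mul (ξ₀ ξ : H1) : H1 :=
  (ξ₀.1 + ξ.1, ξ₀.2.1 + ξ.2.1, ξ₀.2.2 + ξ.2.2 + 2 * (ξ.1 * ξ₀.2.1 - ξ.2.1 * ξ₀.1))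

/-- The gauge `ρ(x, y, t) = ((x² + y²)² + t²)^{1/4}`. -/
def gauge (ξ : H1) : ℝ :=
  ((ξ.1 ^ 2 + ξ.2.1 ^ 2) ^ 2 + ξ.2.2 ^ 2) ^ (1 / 4 : ℝ)

/-- The distance `d(ξ, ξ₀) = ρ(ξ₀⁻¹ ∘ ξ)`. -/
def gaugeDist (ξ ξ₀ : H1) : ℝ :=
  gauge (mul (-ξ₀) ξ)

/-- The open ball `B_R(ξ₀) = {ξ : d(ξ, ξ₀) < R}`. -/
def gaugeBall (ξ₀ : H1) (R : ℝ) : Set H1 :=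
  {ξ | gaugeDist ξ ξ₀ < R}

/-- The punctured ball `{ξ : 0 < d(ξ, ξ₀) < R}`. -/
def puncturedBall (ξ₀ : H1) (R : ℝ) : Set H1 :=
  {ξ | 0 < gaugeDist ξ ξ₀ ∧ gaugeDist ξ ξ₀ < R}

/-- The vector field `X = ∂_x + 2 y ∂_t`. -/
def X (f : H1 → ℝ) (ξ : H1) : ℝ :=
  fderiv ℝ f ξ (1, 0, 2 * ξ.2.1)

/-- The vector field `Y = ∂_y - 2 x ∂_t`. -/
def Y (f : H1 → ℝ) (ξ : H1) : ℝ :=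
  fderiv ℝ f ξ (0, 1, -2 * ξ.1)

/-- The vector field `∂_t`. -/
def T (f : H1 → ℝ) (ξ : H1) : ℝ :=
  fderiv ℝ f ξ (0, 0, 1)

/-- The symmetrized horizontal Hessian `𝓗(f)`. -/
def horizontalHessian (f : H1 → ℝ) (ξ : H1) : Matrix (Fin 2) (Fin 2) ℝ :=
  !![X (X f) ξ, (X (Y f) ξ + Y (X f) ξ) / 2;
     (X (Y f) ξ + Y (X f) ξ) / 2, Y (Y f) ξ]

/-- `𝓗`-convexity of a `C²` function on an open set `Ω`. -/
structure HConvexOn (Ω : Set H1) (f : H1 → ℝ) : Prop where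
  contDiffOn : ContDiffOn ℝ 2 f Ω
  posSemidef : ∀ ξ ∈ Ω, (horizontalHessian f ξ).PosSemidef

/-- The operator `det 𝓗(f) + 12 (∂_t f)²`. -/
def mongeAmpere (f : H1 → ℝ) (ξ : H1) : ℝ :=
  (horizontalHessian f ξ).det + 12 * T f ξ ^ 2

end Heisenberg

end

open MeasureTheory Filter Topology
open scoped Manifold ContDiff ENNReal

noncomputable section

namespace Heisenberg

/-! ### Exchanging mixed derivatives under the integral for functions that are only C¹. -/

section Commute

variable {E : Type*} [NormedAddCommGroup E] [NormedSpace ℝ E]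

/-! Write `M` for `mongeAmpere` and w = v - u, σ = v + u. Since `M` is quadratic in the second and
first derivatives, 2(M(v) - M(u)) is the linearized operator at σ applied to w
(`linearized_add_sub`). The constant 12 makes this operator a divergence. As X and Y do not commute,
the cofactor rows of 𝓗(σ) are not divergence free, but they become so after an antisymmetric
correction by ±6 ∂_tσ, which recombines through XY - YX = -4∂_t into 24 ∂_tσ ∂_t w. Being
antisymmetric, it drops out of the quadratic form in the horizontal gradient of w. Hence
(`integral_linearized`) ∫ η(w)·2(M(v) - M(u)) = -∫ η'(w) ⟨cof 𝓗(σ) ∇w, ∇w⟩, which is nonnegative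
when η is nonincreasing and 𝓗(σ) is positive semidefinite. With C² functions third derivatives are
unavailable, so all of this is done weakly.

To use it with η close to the indicator of the negative half-line, one needs v ≤ u and compact sets
{w ≤ -δ} in the punctured ball. The functions v and u agree on the sphere and at the centre. The
cone u has a horizontal Hessian of rank at most one (`horizontalHessian_cone`); along its null
direction w has nonnegative second derivative, so the maximum principle `nonpos_of_exists_direction`
gives v ≤ u, and compactness follows.

As δ → 0, Fatou's lemma settles {v < u}. On the contact set {v = u}, w has an interior maximum, so
∂_t v = ∂_t u, while det 𝓗(u) = 0 ≤ det 𝓗(v) (`lintegral_mongeAmpere_le`). The comparison is between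
integrals with values in [0, ∞], so integrability of M(u) near the vertex of the cone is a
consequence of it. -/

theorem continuous_fderiv_apply_const {f : E → ℝ} (hf : ContDiff ℝ 1 f) (a : E) :
    Continuous fun ξ ↦ fderiv ℝ f ξ a :=
  (hf.continuous_fderiv one_ne_zero).clm_apply continuous_const

variable [MeasurableSpace E] [BorelSpace E]

/-- Moving `f` rather than `k` puts the derivative on `f` alone, so `k` may itself be a first
derivative of a C¹ function. -/
theorem hasDerivAt_integral_translate (μ : Measure E) [μ.IsAddHaarMeasure]
    {f k : E → ℝ} (hf : ContDiff ℝ 1 f) (hfc : HasCompactSupport f)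
    (hk : Continuous k) (hkc : HasCompactSupport k) (a : E) :
    HasDerivAt (fun h : ℝ ↦ ∫ ξ, f (ξ + h • a) * k ξ ∂μ) (∫ ξ, fderiv ℝ f ξ a * k ξ ∂μ) 0 := by
  have hdc : Continuous fun ξ ↦ fderiv ℝ f ξ a := continuous_fderiv_apply_const hf a
  have hds : HasCompactSupport fun ξ ↦ fderiv ℝ f ξ a := hfc.fderiv_apply ℝ a
  obtain ⟨C, hC⟩ := hds.exists_bound_of_continuous hdc
  have key := hasDerivAt_integral_of_dominated_loc_of_deriv_le (μ := μ) (𝕜 := ℝ) (x₀ := 0)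
    (s := Set.univ) (F := fun h ξ ↦ f (ξ + h • a) * k ξ)
    (F' := fun h ξ ↦ fderiv ℝ f (ξ + h • a) a * k ξ) (bound := fun ξ ↦ C * ‖k ξ‖) univ_mem
    (Eventually.of_forall fun h ↦ by
      have := hf.continuous
      exact Continuous.aestronglyMeasurable (by fun_prop))
    (by
      have := hf.continuous
      exact Continuous.integrable_of_hasCompactSupport (by fun_prop) hkc.mul_left)
    (by
      refine Continuous.aestronglyMeasurable ?_
      exact (hdc.comp (by fun_prop)).mul hk)
    (Eventually.of_forall fun ξ h _ ↦ by
      rw [norm_mul]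
      exact mul_le_mul_of_nonneg_right (hC _) (norm_nonneg _))
    ((hk.norm.integrable_of_hasCompactSupport hkc.norm).const_mul C)
    (Eventually.of_forall fun ξ h _ ↦ by
      have h1 : HasDerivAt (fun s : ℝ ↦ ξ + s • a) a h := by
        simpa using ((hasDerivAt_id h).smul_const a).const_add ξ
      have h2 := ((hf.differentiable one_ne_zero) (ξ + h • a)).hasFDerivAt.comp_hasDerivAt h h1
      exact h2.mul_const _)
  simpa using key.2

/-- Mixed directional derivatives of two functions of class `C¹` may be exchanged under the
integral sign. -/
theorem integral_fderiv_mul_fderiv_comm [FiniteDimensional ℝ E] (μ : Measure E)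
    [μ.IsAddHaarMeasure] {f g : E → ℝ} (hf : ContDiff ℝ 1 f) (hg : ContDiff ℝ 1 g)
    (hfc : HasCompactSupport f) (hgc : HasCompactSupport g) (a b : E) :
    ∫ ξ, fderiv ℝ f ξ a * fderiv ℝ g ξ b ∂μ = ∫ ξ, fderiv ℝ f ξ b * fderiv ℝ g ξ a ∂μ := by
  have hfb := continuous_fderiv_apply_const hf b
  have hgb := continuous_fderiv_apply_const hg b
  have hfbs : HasCompactSupport fun ξ ↦ fderiv ℝ f ξ b := hfc.fderiv_apply ℝ b
  have hgbs : HasCompactSupport fun ξ ↦ fderiv ℝ g ξ b := hgc.fderiv_apply ℝ b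
  have h1 := hasDerivAt_integral_translate μ hf hfc hgb hgbs a
  have h2 := hasDerivAt_integral_translate μ hg hgc hfb hfbs (-a)
  -- Integration by parts along `b`, then the translation ξ ↦ ξ - h a, moves both operations to the
  -- other factor. Differentiating the two expressions at h = 0 gives the two sides, without any
  -- second derivative.
  have h3 : (fun h : ℝ ↦ ∫ ξ, f (ξ + h • a) * fderiv ℝ g ξ b ∂μ) =
      fun h : ℝ ↦ -∫ ξ, g (ξ + h • -a) * fderiv ℝ f ξ b ∂μ := by
    funext h
    have hsh : ∀ ξ, fderiv ℝ (fun ζ ↦ f (ζ + h • a)) ξ = fderiv ℝ f (ξ + h • a) :=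
      fun ξ ↦ fderiv_comp_add_right (h • a)
    have hc := hf.continuous
    have hgc' := hg.continuous
    rw [integral_mul_fderiv_eq_neg_fderiv_mul_of_integrable (f := fun ξ ↦ f (ξ + h • a))]
    · congr 1
      rw [← integral_add_right_eq_self (fun ξ ↦ g (ξ + h • -a) * fderiv ℝ f ξ b) (h • a)]
      refine integral_congr_ae (Eventually.of_forall fun ξ ↦ ?_)
      simp only [hsh]
      rw [mul_comm]
      simp
    · simp only [hsh]
      exact Continuous.integrable_of_hasCompactSupport
        ((hfb.comp (continuous_id.add continuous_const)).mul hgc') hgc.mul_left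
    · exact Continuous.integrable_of_hasCompactSupport
        ((hc.comp (continuous_id.add continuous_const)).mul hgb) hgbs.mul_left
    · exact Continuous.integrable_of_hasCompactSupport
        ((hc.comp (continuous_id.add continuous_const)).mul hgc') hgc.mul_left
    · intro ξ _
      exact ((hf.differentiable one_ne_zero) _).comp ξ (by fun_prop)
    · intro ξ _
      exact (hg.differentiable one_ne_zero) _
  rw [h3] at h1
  have h4 := h1.unique h2.neg
  rw [h4, ← integral_neg]
  refine integral_congr_ae (Eventually.of_forall fun ξ ↦ ?_)
  simp [mul_comm]

/-- The variable-coefficient form of `integral_fderiv_mul_fderiv_comm`. -/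
theorem integral_mul_fderiv_wedge [FiniteDimensional ℝ E] (μ : Measure E)
    [μ.IsAddHaarMeasure] {c f g : E → ℝ} (hc : ContDiff ℝ 1 c) (hf : ContDiff ℝ 1 f)
    (hg : ContDiff ℝ 1 g) (hfc : HasCompactSupport f) (hgc : HasCompactSupport g) (a b : E) :
    ∫ ξ, (c ξ * (fderiv ℝ f ξ a * fderiv ℝ g ξ b - fderiv ℝ f ξ b * fderiv ℝ g ξ a) +
      f ξ * (fderiv ℝ c ξ a * fderiv ℝ g ξ b - fderiv ℝ c ξ b * fderiv ℝ g ξ a)) ∂μ = 0 := by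
  have hcf : ContDiff ℝ 1 fun ξ ↦ c ξ * f ξ := hc.mul hf
  have hcfs : HasCompactSupport fun ξ ↦ c ξ * f ξ := hfc.mul_left
  have h := integral_fderiv_mul_fderiv_comm μ hcf hg hcfs hgc a b
  have hi : ∀ a b : E, Integrable
      (fun ξ ↦ fderiv ℝ (fun ξ ↦ c ξ * f ξ) ξ a * fderiv ℝ g ξ b) μ := fun a b ↦
    Continuous.integrable_of_hasCompactSupport
      ((continuous_fderiv_apply_const hcf a).mul (continuous_fderiv_apply_const hg b))
      ((hgc.fderiv_apply ℝ b).mul_left)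
  rw [← sub_eq_zero, ← integral_sub (hi a b) (hi b a)] at h
  rw [← h]
  refine integral_congr_ae (Eventually.of_forall fun ξ ↦ ?_)
  have hd : fderiv ℝ (fun ξ ↦ c ξ * f ξ) ξ = _ :=
    fderiv_fun_mul ((hc.differentiable one_ne_zero) ξ) ((hf.differentiable one_ne_zero) ξ)
  simp only [hd]
  simp
  ring

end Commute

/-! ### The vector fields X, Y, ∂_t and their second-order compositions. -/

instance : (volume : Measure H1).IsAddHaarMeasure :=
  Measure.prod.instIsAddHaarMeasure (volume : Measure ℝ) (volume : Measure (ℝ × ℝ))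

theorem X_eq (f : H1 → ℝ) (ξ : H1) :
    X f ξ = fderiv ℝ f ξ (1, 0, 0) + 2 * ξ.2.1 * fderiv ℝ f ξ (0, 0, 1) := by
  have : ((1, 0, 2 * ξ.2.1) : H1) = (1, 0, 0) + (2 * ξ.2.1) • (0, 0, 1) := by simp
  rw [X, this, map_add, map_smul, smul_eq_mul]

theorem Y_eq (f : H1 → ℝ) (ξ : H1) :
    Y f ξ = fderiv ℝ f ξ (0, 1, 0) - 2 * ξ.1 * fderiv ℝ f ξ (0, 0, 1) := by
  have : ((0, 1, -2 * ξ.1) : H1) = (0, 1, 0) + (-2 * ξ.1) • (0, 0, 1) := by simp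
  rw [Y, this, map_add, map_smul, smul_eq_mul]
  ring

theorem fderiv_fderiv_apply {f : H1 → ℝ} {ξ : H1} (hf : ContDiffAt ℝ 2 f ξ) {e : H1 → H1}
    {e' : H1 →L[ℝ] H1} (he : HasFDerivAt e e' ξ) (a : H1) :
    fderiv ℝ (fun ζ ↦ fderiv ℝ f ζ (e ζ)) ξ a =
      fderiv ℝ (fderiv ℝ f) ξ a (e ξ) + fderiv ℝ f ξ (e' a) := by
  have h1 : ContDiffAt ℝ 1 (fderiv ℝ f) ξ := hf.fderiv_right (by norm_num)
  have h2 := (h1.differentiableAt one_ne_zero).hasFDerivAt.clm_apply he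
  rw [h2.fderiv]
  simp [add_comm]

/-- The derivative of the coefficient vector of `X`. -/
def dX : H1 →L[ℝ] H1 :=
  (0 : H1 →L[ℝ] ℝ).prod ((0 : H1 →L[ℝ] ℝ).prod
    ((2 : ℝ) • (ContinuousLinearMap.fst ℝ ℝ ℝ).comp (ContinuousLinearMap.snd ℝ ℝ (ℝ × ℝ))))

/-- The derivative of the coefficient vector of `Y`. -/
def dY : H1 →L[ℝ] H1 :=
  (0 : H1 →L[ℝ] ℝ).prod ((0 : H1 →L[ℝ] ℝ).prod
    ((-2 : ℝ) • ContinuousLinearMap.fst ℝ ℝ (ℝ × ℝ)))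

theorem hasFDerivAt_coeffX (ξ : H1) :
    HasFDerivAt (fun ζ : H1 ↦ ((1, 0, 2 * ζ.2.1) : H1)) dX ξ := by
  have : (fun ζ : H1 ↦ ((1, 0, 2 * ζ.2.1) : H1)) = fun ζ ↦ (1, 0, 0) + dX ζ := by
    funext ζ; simp [dX]
  rw [this]
  exact dX.hasFDerivAt.const_add _

theorem hasFDerivAt_coeffY (ξ : H1) :
    HasFDerivAt (fun ζ : H1 ↦ ((0, 1, -2 * ζ.1) : H1)) dY ξ := by
  have : (fun ζ : H1 ↦ ((0, 1, -2 * ζ.1) : H1)) = fun ζ ↦ (0, 1, 0) + dY ζ := by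
    funext ζ; simp [dY]
  rw [this]
  exact dY.hasFDerivAt.const_add _

section SecondOrder

variable {f : H1 → ℝ} {ξ : H1}

/-- No first-order term appears because the coefficient 2y of X is constant along X; likewise -2x
along Y. In the mixed products the corresponding terms survive as ∓2∂_t, and they cancel in `mixed`.
-/
theorem X_X_eq (hf : ContDiffAt ℝ 2 f ξ) :
    X (X f) ξ = fderiv ℝ (fderiv ℝ f) ξ (1, 0, 2 * ξ.2.1) (1, 0, 2 * ξ.2.1) := by
  have h := fderiv_fderiv_apply hf (hasFDerivAt_coeffX ξ) (1, 0, 2 * ξ.2.1)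
  have h0 : dX (1, 0, 2 * ξ.2.1) = 0 := by simp [dX]
  rw [h0, map_zero, add_zero] at h
  exact h

theorem Y_Y_eq (hf : ContDiffAt ℝ 2 f ξ) :
    Y (Y f) ξ = fderiv ℝ (fderiv ℝ f) ξ (0, 1, -2 * ξ.1) (0, 1, -2 * ξ.1) := by
  have h := fderiv_fderiv_apply hf (hasFDerivAt_coeffY ξ) (0, 1, -2 * ξ.1)
  have h0 : dY (0, 1, -2 * ξ.1) = 0 := by simp [dY]
  rw [h0, map_zero, add_zero] at h
  exact h

theorem X_Y_eq (hf : ContDiffAt ℝ 2 f ξ) :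
    X (Y f) ξ =
      fderiv ℝ (fderiv ℝ f) ξ (1, 0, 2 * ξ.2.1) (0, 1, -2 * ξ.1) - 2 * T f ξ := by
  have h := fderiv_fderiv_apply hf (hasFDerivAt_coeffY ξ) (1, 0, 2 * ξ.2.1)
  have h0 : dY (1, 0, 2 * ξ.2.1) = (-2 : ℝ) • (0, 0, 1) := by simp [dY]
  rw [h0, map_smul] at h
  refine h.trans ?_
  simp [T]
  ring

theorem Y_X_eq (hf : ContDiffAt ℝ 2 f ξ) :
    Y (X f) ξ =
      fderiv ℝ (fderiv ℝ f) ξ (1, 0, 2 * ξ.2.1) (0, 1, -2 * ξ.1) + 2 * T f ξ := by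
  have h := fderiv_fderiv_apply hf (hasFDerivAt_coeffX ξ) (0, 1, -2 * ξ.1)
  have h0 : dX (0, 1, -2 * ξ.1) = (2 : ℝ) • (0, 0, 1) := by simp [dX]
  have hs : IsSymmSndFDerivAt ℝ f ξ := hf.isSymmSndFDerivAt (by simp)
  rw [h0, map_smul, hs.eq] at h
  exact h

theorem X_Y_sub_Y_X (hf : ContDiffAt ℝ 2 f ξ) : X (Y f) ξ - Y (X f) ξ = -4 * T f ξ := by
  rw [X_Y_eq hf, Y_X_eq hf]; ring

/-- The off-diagonal entry of the symmetrized horizontal Hessian. -/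
def mixed (f : H1 → ℝ) (ξ : H1) : ℝ := (X (Y f) ξ + Y (X f) ξ) / 2

theorem mixed_eq (hf : ContDiffAt ℝ 2 f ξ) :
    mixed f ξ = fderiv ℝ (fderiv ℝ f) ξ (1, 0, 2 * ξ.2.1) (0, 1, -2 * ξ.1) := by
  rw [mixed, X_Y_eq hf, Y_X_eq hf]; ring

theorem mongeAmpere_eq (f : H1 → ℝ) (ξ : H1) :
    mongeAmpere f ξ = X (X f) ξ * Y (Y f) ξ - mixed f ξ ^ 2 + 12 * T f ξ ^ 2 := by
  simp [mongeAmpere, horizontalHessian, Matrix.det_fin_two, mixed, sq]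

/-- The second derivative along a horizontal vector is the quadratic form of the
horizontal Hessian. -/
theorem fderiv_fderiv_horizontal (hf : ContDiffAt ℝ 2 f ξ) (a b : ℝ) :
    fderiv ℝ (fderiv ℝ f) ξ (a, b, 2 * (a * ξ.2.1 - b * ξ.1))
      (a, b, 2 * (a * ξ.2.1 - b * ξ.1)) =
      a ^ 2 * X (X f) ξ + 2 * a * b * mixed f ξ + b ^ 2 * Y (Y f) ξ := by
  have he : ((a, b, 2 * (a * ξ.2.1 - b * ξ.1)) : H1) =
      a • (1, 0, 2 * ξ.2.1) + b • (0, 1, -2 * ξ.1) := by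
    simp; ring
  have hs : IsSymmSndFDerivAt ℝ f ξ := hf.isSymmSndFDerivAt (by simp)
  rw [X_X_eq hf, Y_Y_eq hf, mixed_eq hf, he]
  simp only [map_add, map_smul, add_apply, smul_apply,
    smul_eq_mul]
  rw [hs.eq (0, 1, -2 * ξ.1) (1, 0, 2 * ξ.2.1)]
  ring

end SecondOrder

/-! ### Regularity, supports and Leibniz rules for X, Y, ∂_t. -/

section Regularity

variable {f : H1 → ℝ}

theorem contDiff_X {n : ℕ} (hf : ContDiff ℝ (n + 1) f) : ContDiff ℝ n (X f) := by
  have h : ContDiff ℝ n (fderiv ℝ f) := hf.fderiv_right le_rfl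
  exact h.clm_apply (by fun_prop)

theorem contDiff_Y {n : ℕ} (hf : ContDiff ℝ (n + 1) f) : ContDiff ℝ n (Y f) := by
  have h : ContDiff ℝ n (fderiv ℝ f) := hf.fderiv_right le_rfl
  exact h.clm_apply (by fun_prop)

theorem contDiff_T {n : ℕ} (hf : ContDiff ℝ (n + 1) f) : ContDiff ℝ n (T f) := by
  have h : ContDiff ℝ n (fderiv ℝ f) := hf.fderiv_right le_rfl
  exact h.clm_apply (by fun_prop)

theorem continuous_X (hf : ContDiff ℝ 1 f) : Continuous (X f) :=
  (contDiff_X (n := 0) (by simpa using hf)).continuous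

theorem continuous_Y (hf : ContDiff ℝ 1 f) : Continuous (Y f) :=
  (contDiff_Y (n := 0) (by simpa using hf)).continuous

theorem continuous_T (hf : ContDiff ℝ 1 f) : Continuous (T f) :=
  (contDiff_T (n := 0) (by simpa using hf)).continuous

theorem contDiff_one_X (hf : ContDiff ℝ 2 f) : ContDiff ℝ 1 (X f) :=
  contDiff_X (n := 1) (by simpa [one_add_one_eq_two] using hf)

theorem contDiff_one_Y (hf : ContDiff ℝ 2 f) : ContDiff ℝ 1 (Y f) :=
  contDiff_Y (n := 1) (by simpa [one_add_one_eq_two] using hf)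

theorem hasCompactSupport_X (hf : HasCompactSupport f) : HasCompactSupport (X f) :=
  (hf.fderiv ℝ).mono fun ξ hξ h ↦ hξ (by simp [X, h])

theorem hasCompactSupport_Y (hf : HasCompactSupport f) : HasCompactSupport (Y f) :=
  (hf.fderiv ℝ).mono fun ξ hξ h ↦ hξ (by simp [Y, h])

theorem hasCompactSupport_T (hf : HasCompactSupport f) : HasCompactSupport (T f) :=
  (hf.fderiv ℝ).mono fun ξ hξ h ↦ hξ (by simp [T, h])

theorem continuous_mixed (hf : ContDiff ℝ 2 f) : Continuous (mixed f) :=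
  ((continuous_X (contDiff_one_Y hf)).add (continuous_Y (contDiff_one_X hf))).div_const 2

end Regularity

section Leibniz

variable {f g : H1 → ℝ} {ξ : H1}

theorem X_mul (hf : DifferentiableAt ℝ f ξ) (hg : DifferentiableAt ℝ g ξ) :
    X (fun ζ ↦ f ζ * g ζ) ξ = f ξ * X g ξ + g ξ * X f ξ := by
  simp [X, fderiv_fun_mul hf hg]

theorem Y_mul (hf : DifferentiableAt ℝ f ξ) (hg : DifferentiableAt ℝ g ξ) :
    Y (fun ζ ↦ f ζ * g ζ) ξ = f ξ * Y g ξ + g ξ * Y f ξ := by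
  simp [Y, fderiv_fun_mul hf hg]

theorem X_comp {η : ℝ → ℝ} (hη : DifferentiableAt ℝ η (f ξ)) (hf : DifferentiableAt ℝ f ξ) :
    X (fun ζ ↦ η (f ζ)) ξ = deriv η (f ξ) * X f ξ := by
  have h := hη.hasDerivAt.comp_hasFDerivAt ξ hf.hasFDerivAt
  have h' : fderiv ℝ (fun ζ ↦ η (f ζ)) ξ = _ := h.fderiv
  simp [X, h']

theorem Y_comp {η : ℝ → ℝ} (hη : DifferentiableAt ℝ η (f ξ)) (hf : DifferentiableAt ℝ f ξ) :
    Y (fun ζ ↦ η (f ζ)) ξ = deriv η (f ξ) * Y f ξ := by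
  have h := hη.hasDerivAt.comp_hasFDerivAt ξ hf.hasFDerivAt
  have h' : fderiv ℝ (fun ζ ↦ η (f ζ)) ξ = _ := h.fderiv
  simp [Y, h']

end Leibniz

/-! ### Weak divergence identities and the linearized operator. -/

section IntegralIdentities

variable {f g : H1 → ℝ}

theorem integrable_fderiv_mul_fderiv (hf : ContDiff ℝ 1 f) (hg : ContDiff ℝ 1 g)
    (hgc : HasCompactSupport g) {c : H1 → ℝ} (hc : Continuous c) (a b : H1) :
    Integrable fun ξ ↦ c ξ * (fderiv ℝ f ξ a * fderiv ℝ g ξ b) :=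
  Continuous.integrable_of_hasCompactSupport
    (hc.mul ((continuous_fderiv_apply_const hf a).mul (continuous_fderiv_apply_const hg b)))
    ((hgc.fderiv_apply ℝ b).mul_left.mul_left)

/-- The weak form of [∂_t, Y] = 0: the products of two t-derivatives cancel, leaving a coordinate
wedge with constant coefficient. -/
theorem integral_T_mul_Y (hf : ContDiff ℝ 1 f) (hg : ContDiff ℝ 1 g)
    (hfc : HasCompactSupport f) (hgc : HasCompactSupport g) :
    ∫ ξ, (T f ξ * Y g ξ - Y f ξ * T g ξ) = 0 := by
  have h := integral_mul_fderiv_wedge volume (contDiff_const (c := (1 : ℝ))) hf hg hfc hgc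
    ((0, 0, 1) : H1) (0, 1, 0)
  rw [← h]
  refine integral_congr_ae (Eventually.of_forall fun ξ ↦ ?_)
  simp only [T, Y_eq]
  simp
  ring

theorem integral_T_mul_X (hf : ContDiff ℝ 1 f) (hg : ContDiff ℝ 1 g)
    (hfc : HasCompactSupport f) (hgc : HasCompactSupport g) :
    ∫ ξ, (T f ξ * X g ξ - X f ξ * T g ξ) = 0 := by
  have h := integral_mul_fderiv_wedge volume (contDiff_const (c := (1 : ℝ))) hf hg hfc hgc
    ((0, 0, 1) : H1) (1, 0, 0)
  rw [← h]
  refine integral_congr_ae (Eventually.of_forall fun ξ ↦ ?_)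
  simp only [T, X_eq]
  simp
  ring

theorem integrable_wedge {c : H1 → ℝ} (hc : ContDiff ℝ 1 c) (hf : ContDiff ℝ 1 f)
    (hg : ContDiff ℝ 1 g) (hgc : HasCompactSupport g) (a b : H1) :
    Integrable fun ξ ↦ (c ξ * (fderiv ℝ f ξ a * fderiv ℝ g ξ b - fderiv ℝ f ξ b * fderiv ℝ g ξ a) +
      f ξ * (fderiv ℝ c ξ a * fderiv ℝ g ξ b - fderiv ℝ c ξ b * fderiv ℝ g ξ a)) := by
  have h1 := integrable_fderiv_mul_fderiv hf hg hgc hc.continuous a b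
  have h2 := integrable_fderiv_mul_fderiv hf hg hgc hc.continuous b a
  have h3 := integrable_fderiv_mul_fderiv hc hg hgc hf.continuous a b
  have h4 := integrable_fderiv_mul_fderiv hc hg hgc hf.continuous b a
  refine ((h1.sub h2).add (h3.sub h4)).congr (Eventually.of_forall fun ξ ↦ ?_)
  simp only [Pi.add_apply, Pi.sub_apply]
  ring

/-- The weak form of XY - YX = -4∂_t. -/
theorem integral_Y_mul_X (hf : ContDiff ℝ 1 f) (hg : ContDiff ℝ 1 g)
    (hfc : HasCompactSupport f) (hgc : HasCompactSupport g) :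
    ∫ ξ, (Y f ξ * X g ξ - X f ξ * Y g ξ + 4 * (f ξ * T g ξ)) = 0 := by
  -- The integrand splits into coordinate wedges with coefficients 1, 2y and 2x. Differentiating 2y
  -- and 2x each contributes 2 f ∂_t g, whence the 4.
  set L : H1 →L[ℝ] ℝ :=
    (2 : ℝ) • (ContinuousLinearMap.fst ℝ ℝ ℝ).comp (ContinuousLinearMap.snd ℝ ℝ (ℝ × ℝ)) with hL
  set M : H1 →L[ℝ] ℝ := (2 : ℝ) • ContinuousLinearMap.fst ℝ ℝ (ℝ × ℝ) with hM
  have c1 : ContDiff ℝ 1 fun _ : H1 ↦ (1 : ℝ) := contDiff_const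
  have h1 := integral_mul_fderiv_wedge volume c1 hf hg hfc hgc ((0, 1, 0) : H1) (1, 0, 0)
  have h2 := integral_mul_fderiv_wedge volume L.contDiff hf hg hfc hgc ((0, 1, 0) : H1) (0, 0, 1)
  have h3 := integral_mul_fderiv_wedge volume M.contDiff hf hg hfc hgc ((1, 0, 0) : H1) (0, 0, 1)
  have i1 := integrable_wedge c1 hf hg hgc ((0, 1, 0) : H1) (1, 0, 0)
  have i2 := integrable_wedge L.contDiff hf hg hgc ((0, 1, 0) : H1) (0, 0, 1)
  have i3 := integrable_wedge M.contDiff hf hg hgc ((1, 0, 0) : H1) (0, 0, 1)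
  have h : ∫ ξ, (_ : ℝ) = _ := integral_add (i1.add i2) i3
  have h' : ∫ ξ, (_ : ℝ) = _ := integral_add i1 i2
  rw [h3, add_zero] at h
  have h'' := h.trans (h'.trans (by rw [h1, h2, add_zero]))
  rw [← h'']
  refine integral_congr_ae (Eventually.of_forall fun ξ ↦ ?_)
  simp only [T, X_eq, Y_eq, Pi.add_apply, ContinuousLinearMap.fderiv]
  simp [hL, hM]
  ring

variable {σ : H1 → ℝ}

theorem integral_cofactor_X (hσ : ContDiff ℝ 2 σ) (hσc : HasCompactSupport σ)
    (hg : ContDiff ℝ 1 g) (hgc : HasCompactSupport g) :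
    ∫ ξ, (Y (Y σ) ξ * X g ξ - mixed σ ξ * Y g ξ + 6 * (T σ ξ * Y g ξ)) = 0 := by
  have hYσ := contDiff_one_Y hσ
  have hσ1 : ContDiff ℝ 1 σ := hσ.of_le (by norm_num)
  have h1 := integral_Y_mul_X hYσ hg (hasCompactSupport_Y hσc) hgc
  have h2 := integral_T_mul_Y hσ1 hg hσc hgc
  have cYY := continuous_Y hYσ
  have cXY := continuous_X hYσ
  have cY := hYσ.continuous
  have cT := continuous_T hσ1
  have gX := continuous_X hg
  have gY := continuous_Y hg
  have gT := continuous_T hg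
  have sX := hasCompactSupport_X hgc
  have sY := hasCompactSupport_Y hgc
  have sT := hasCompactSupport_T hgc
  have i1 : Integrable fun ξ ↦ Y (Y σ) ξ * X g ξ - X (Y σ) ξ * Y g ξ + 4 * (Y σ ξ * T g ξ) :=
    Continuous.integrable_of_hasCompactSupport (by fun_prop)
      ((sX.mul_left.sub sY.mul_left).add sT.mul_left.mul_left)
  have i2 : Integrable fun ξ ↦ T σ ξ * Y g ξ - Y σ ξ * T g ξ :=
    Continuous.integrable_of_hasCompactSupport (by fun_prop) (sY.mul_left.sub sT.mul_left)
  -- The factor 4 trades Yσ ∂_t g for ∂_tσ Y g. Together with XYσ = `mixed` - 2∂_tσ this gives the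
  -- coefficient 4 + 2 = 6.
  have h : ∫ ξ, (_ : ℝ) = _ := integral_add i1 (i2.const_mul 4)
  rw [h1, integral_const_mul, h2, mul_zero, add_zero] at h
  rw [← h]
  refine integral_congr_ae (Eventually.of_forall fun ξ ↦ ?_)
  have hc := X_Y_sub_Y_X (ξ := ξ) hσ.contDiffAt
  simp only [mixed]
  linear_combination (Y g ξ / 2) * hc

theorem integral_cofactor_Y (hσ : ContDiff ℝ 2 σ) (hσc : HasCompactSupport σ)
    (hg : ContDiff ℝ 1 g) (hgc : HasCompactSupport g) :
    ∫ ξ, (X (X σ) ξ * Y g ξ - mixed σ ξ * X g ξ - 6 * (T σ ξ * X g ξ)) = 0 := by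
  have hXσ := contDiff_one_X hσ
  have hσ1 : ContDiff ℝ 1 σ := hσ.of_le (by norm_num)
  have h1 := integral_Y_mul_X hXσ hg (hasCompactSupport_X hσc) hgc
  have h2 := integral_T_mul_X hσ1 hg hσc hgc
  have cXX := continuous_X hXσ
  have cYX := continuous_Y hXσ
  have cX := hXσ.continuous
  have cT := continuous_T hσ1
  have gX := continuous_X hg
  have gY := continuous_Y hg
  have gT := continuous_T hg
  have sX := hasCompactSupport_X hgc
  have sY := hasCompactSupport_Y hgc
  have sT := hasCompactSupport_T hgc
  have i1 : Integrable fun ξ ↦ Y (X σ) ξ * X g ξ - X (X σ) ξ * Y g ξ + 4 * (X σ ξ * T g ξ) :=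
    Continuous.integrable_of_hasCompactSupport (by fun_prop)
      ((sX.mul_left.sub sY.mul_left).add sT.mul_left.mul_left)
  have i2 : Integrable fun ξ ↦ T σ ξ * X g ξ - X σ ξ * T g ξ :=
    Continuous.integrable_of_hasCompactSupport (by fun_prop) (sX.mul_left.sub sT.mul_left)
  have h : ∫ ξ, (_ : ℝ) = _ := integral_add i1.neg (i2.const_mul (-4))
  rw [integral_const_mul, h2, integral_neg' , h1, mul_zero, add_zero, neg_zero] at h
  rw [← h]
  refine integral_congr_ae (Eventually.of_forall fun ξ ↦ ?_)
  have hc := X_Y_sub_Y_X (ξ := ξ) hσ.contDiffAt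
  simp only [mixed, Pi.neg_apply]
  linear_combination (-X g ξ / 2) * hc

/-- The linearization at `σ` of twice the operator `mongeAmpere`, in the direction `w`. -/
def linearized (σ w : H1 → ℝ) (ξ : H1) : ℝ :=
  Y (Y σ) ξ * X (X w) ξ + X (X σ) ξ * Y (Y w) ξ - 2 * (mixed σ ξ * mixed w ξ) +
    24 * (T σ ξ * T w ξ)

/-- The cofactor matrix of the horizontal Hessian of `σ`, as a quadratic form evaluated at the
horizontal gradient of `w`. -/
def cofactorForm (σ w : H1 → ℝ) (ξ : H1) : ℝ :=
  Y (Y σ) ξ * X w ξ ^ 2 + X (X σ) ξ * Y w ξ ^ 2 - 2 * (mixed σ ξ * (X w ξ * Y w ξ))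

theorem continuous_cofactorForm {w : H1 → ℝ} (hσ : ContDiff ℝ 2 σ) (hw : ContDiff ℝ 2 w) :
    Continuous (cofactorForm σ w) := by
  have h1 := continuous_Y (contDiff_one_Y hσ)
  have h2 := continuous_X (contDiff_one_X hσ)
  have h5 := continuous_mixed hσ
  have h7 := continuous_X (hw.of_le (by norm_num))
  have h8 := continuous_Y (hw.of_le (by norm_num))
  unfold cofactorForm
  fun_prop

/-- The weak divergence structure of the operator `mongeAmpere`. -/
theorem integral_linearized {w : H1 → ℝ} {η : ℝ → ℝ} (hσ : ContDiff ℝ 2 σ)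
    (hσc : HasCompactSupport σ) (hw : ContDiff ℝ 2 w) (hwc : HasCompactSupport w)
    (hη : ContDiff ℝ 1 η) :
    ∫ ξ, (η (w ξ) * linearized σ w ξ + deriv η (w ξ) * cofactorForm σ w ξ) = 0 := by
  have hw1 : ContDiff ℝ 1 w := hw.of_le (by norm_num)
  have hσ1 : ContDiff ℝ 1 σ := hσ.of_le (by norm_num)
  have hXw := contDiff_one_X hw
  have hYw := contDiff_one_Y hw
  have hφ : ContDiff ℝ 1 fun ξ ↦ η (w ξ) := hη.comp hw1
  have hg1 : ContDiff ℝ 1 fun ξ ↦ η (w ξ) * X w ξ := hφ.mul hXw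
  have hg2 : ContDiff ℝ 1 fun ξ ↦ η (w ξ) * Y w ξ := hφ.mul hYw
  have hs1 : HasCompactSupport fun ξ ↦ η (w ξ) * X w ξ := (hasCompactSupport_X hwc).mul_left
  have hs2 : HasCompactSupport fun ξ ↦ η (w ξ) * Y w ξ := (hasCompactSupport_Y hwc).mul_left
  -- The test functions are the components of η(w) times the horizontal gradient of w. The terms 6
  -- ∂_tσ η'(w) Xw Yw from the two identities cancel, and 6 ∂_tσ η(w)(YXw - XYw) becomes 24 ∂_tσ ∂_t
  -- w η(w).
  have h1 := integral_cofactor_X hσ hσc hg1 hs1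
  have h2 := integral_cofactor_Y hσ hσc hg2 hs2
  have cYY := continuous_Y (contDiff_one_Y hσ)
  have cXX := continuous_X (contDiff_one_X hσ)
  have cM := continuous_mixed hσ
  have cT := continuous_T hσ1
  have c1 := continuous_X hg1
  have c2 := continuous_Y hg1
  have c3 := continuous_X hg2
  have c4 := continuous_Y hg2
  have s1 := hasCompactSupport_X hs1
  have s2 := hasCompactSupport_Y hs1
  have s3 := hasCompactSupport_X hs2
  have s4 := hasCompactSupport_Y hs2
  set g₁ := fun ξ ↦ η (w ξ) * X w ξ with hg₁
  set g₂ := fun ξ ↦ η (w ξ) * Y w ξ with hg₂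
  have i1 : Integrable fun ξ ↦ Y (Y σ) ξ * X g₁ ξ - mixed σ ξ * Y g₁ ξ + 6 * (T σ ξ * Y g₁ ξ) :=
    Continuous.integrable_of_hasCompactSupport (by fun_prop)
      ((s1.mul_left.sub s2.mul_left).add s2.mul_left.mul_left)
  have i2 : Integrable fun ξ ↦ X (X σ) ξ * Y g₂ ξ - mixed σ ξ * X g₂ ξ - 6 * (T σ ξ * X g₂ ξ) :=
    Continuous.integrable_of_hasCompactSupport (by fun_prop)
      ((s4.mul_left.sub s3.mul_left).sub s3.mul_left.mul_left)
  have h : ∫ ξ, (_ : ℝ) = _ := integral_add i1 i2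
  rw [h1, h2, add_zero] at h
  rw [← h]
  refine integral_congr_ae (Eventually.of_forall fun ξ ↦ ?_)
  have dφ := hφ.differentiable one_ne_zero ξ
  have dη := hη.differentiable one_ne_zero (w ξ)
  have dw := hw1.differentiable one_ne_zero ξ
  have dX := hXw.differentiable one_ne_zero ξ
  have dY := hYw.differentiable one_ne_zero ξ
  have hc := X_Y_sub_Y_X (ξ := ξ) hw.contDiffAt
  simp only [hg₁, hg₂, linearized, cofactorForm, X_mul dφ dX, Y_mul dφ dX, X_mul dφ dY, Y_mul dφ dY,
    X_comp dη dw, Y_comp dη dw]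
  have hm : mixed w ξ = (X (Y w) ξ + Y (X w) ξ) / 2 := rfl
  rw [hm]
  linear_combination (6 * T σ ξ * η (w ξ)) * hc

end IntegralIdentities

/-! ### Polarization of the operator and its dependence on germs only. -/

section Linearity

variable {f g : H1 → ℝ} {ξ : H1}

theorem fderiv_fderiv_add_const_mul (hf : ContDiffAt ℝ 2 f ξ) (hg : ContDiffAt ℝ 2 g ξ) (c : ℝ) :
    fderiv ℝ (fderiv ℝ fun ζ ↦ f ζ + c * g ζ) ξ =
      fderiv ℝ (fderiv ℝ f) ξ + c • fderiv ℝ (fderiv ℝ g) ξ := by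
  have hfe : ∀ᶠ ζ in 𝓝 ξ, DifferentiableAt ℝ f ζ :=
    (hf.eventually (by simp)).mono fun ζ h ↦ h.differentiableAt two_ne_zero
  have hge : ∀ᶠ ζ in 𝓝 ξ, DifferentiableAt ℝ g ζ :=
    (hg.eventually (by simp)).mono fun ζ h ↦ h.differentiableAt two_ne_zero
  have he : (fderiv ℝ fun ζ ↦ f ζ + c * g ζ) =ᶠ[𝓝 ξ] fun ζ ↦ fderiv ℝ f ζ + c • fderiv ℝ g ζ := by
    filter_upwards [hfe, hge] with ζ h1 h2
    rw [fderiv_fun_add h1 (h2.const_mul c), fderiv_const_mul h2]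
  have h1 : DifferentiableAt ℝ (fderiv ℝ f) ξ :=
    (hf.fderiv_right (m := 1) (by norm_num)).differentiableAt one_ne_zero
  have h2 : DifferentiableAt ℝ (fderiv ℝ g) ξ :=
    (hg.fderiv_right (m := 1) (by norm_num)).differentiableAt one_ne_zero
  rw [he.fderiv_eq]
  exact (h1.hasFDerivAt.add (h2.hasFDerivAt.const_smul c)).fderiv

theorem contDiffAt_add_const_mul (hf : ContDiffAt ℝ 2 f ξ) (hg : ContDiffAt ℝ 2 g ξ) (c : ℝ) :
    ContDiffAt ℝ 2 (fun ζ ↦ f ζ + c * g ζ) ξ :=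
  hf.add (contDiffAt_const.mul hg)

theorem X_X_add_const_mul (hf : ContDiffAt ℝ 2 f ξ) (hg : ContDiffAt ℝ 2 g ξ) (c : ℝ) :
    X (X fun ζ ↦ f ζ + c * g ζ) ξ = X (X f) ξ + c * X (X g) ξ := by
  rw [X_X_eq (contDiffAt_add_const_mul hf hg c), fderiv_fderiv_add_const_mul hf hg, X_X_eq hf,
    X_X_eq hg]
  rfl

theorem Y_Y_add_const_mul (hf : ContDiffAt ℝ 2 f ξ) (hg : ContDiffAt ℝ 2 g ξ) (c : ℝ) :
    Y (Y fun ζ ↦ f ζ + c * g ζ) ξ = Y (Y f) ξ + c * Y (Y g) ξ := by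
  rw [Y_Y_eq (contDiffAt_add_const_mul hf hg c), fderiv_fderiv_add_const_mul hf hg, Y_Y_eq hf,
    Y_Y_eq hg]
  rfl

theorem mixed_add_const_mul (hf : ContDiffAt ℝ 2 f ξ) (hg : ContDiffAt ℝ 2 g ξ) (c : ℝ) :
    mixed (fun ζ ↦ f ζ + c * g ζ) ξ = mixed f ξ + c * mixed g ξ := by
  rw [mixed_eq (contDiffAt_add_const_mul hf hg c), fderiv_fderiv_add_const_mul hf hg, mixed_eq hf,
    mixed_eq hg]
  rfl

theorem T_add_const_mul (hf : ContDiffAt ℝ 2 f ξ) (hg : ContDiffAt ℝ 2 g ξ) (c : ℝ) :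
    T (fun ζ ↦ f ζ + c * g ζ) ξ = T f ξ + c * T g ξ := by
  have h2 := hg.differentiableAt two_ne_zero
  simp [T, fderiv_fun_add (hf.differentiableAt two_ne_zero) (h2.const_mul c), fderiv_const_mul h2]

/-- The polarization identity for the quadratic operator `mongeAmpere`. -/
theorem linearized_add_sub (hf : ContDiffAt ℝ 2 f ξ) (hg : ContDiffAt ℝ 2 g ξ) :
    linearized (fun ζ ↦ f ζ + 1 * g ζ) (fun ζ ↦ f ζ + (-1) * g ζ) ξ =
      2 * (mongeAmpere f ξ - mongeAmpere g ξ) := by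
  simp only [linearized, mongeAmpere_eq, X_X_add_const_mul hf hg, Y_Y_add_const_mul hf hg,
    mixed_add_const_mul hf hg, T_add_const_mul hf hg]
  ring

end Linearity

section Germs

variable {f g : H1 → ℝ} {ξ : H1}

theorem X_congr (h : f =ᶠ[𝓝 ξ] g) : X f =ᶠ[𝓝 ξ] X g :=
  (h.fderiv (𝕜 := ℝ)).mono fun ζ hζ ↦ by simp only [X, hζ]

theorem Y_congr (h : f =ᶠ[𝓝 ξ] g) : Y f =ᶠ[𝓝 ξ] Y g :=
  (h.fderiv (𝕜 := ℝ)).mono fun ζ hζ ↦ by simp only [Y, hζ]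

theorem T_congr (h : f =ᶠ[𝓝 ξ] g) : T f =ᶠ[𝓝 ξ] T g :=
  (h.fderiv (𝕜 := ℝ)).mono fun ζ hζ ↦ by simp only [T, hζ]

theorem mixed_congr (h : f =ᶠ[𝓝 ξ] g) : mixed f ξ = mixed g ξ := by
  rw [mixed, mixed, (X_congr (Y_congr h)).eq_of_nhds, (Y_congr (X_congr h)).eq_of_nhds]

theorem mongeAmpere_congr (h : f =ᶠ[𝓝 ξ] g) : mongeAmpere f ξ = mongeAmpere g ξ := by
  simp only [mongeAmpere_eq, (X_congr (X_congr h)).eq_of_nhds, (Y_congr (Y_congr h)).eq_of_nhds,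
    mixed_congr h, (T_congr h).eq_of_nhds]

end Germs

/-! ### Horizontal derivatives of the fourth power of the gauge distance. -/

section Gauge

variable (ξ₀ : H1)

/-- The fourth power of the gauge distance to `ξ₀`. -/
def quartic (ξ : H1) : ℝ :=
  ((ξ.1 - ξ₀.1) ^ 2 + (ξ.2.1 - ξ₀.2.1) ^ 2) ^ 2 +
    (ξ.2.2 - ξ₀.2.2 + 2 * (ξ.2.1 * ξ₀.1 - ξ.1 * ξ₀.2.1)) ^ 2

/-- The squared distance to `ξ₀` in the horizontal coordinates. -/
def radialSq (ξ : H1) : ℝ := (ξ.1 - ξ₀.1) ^ 2 + (ξ.2.1 - ξ₀.2.1) ^ 2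

theorem gaugeDist_eq (ξ : H1) : gaugeDist ξ ξ₀ = quartic ξ₀ ξ ^ (1 / 4 : ℝ) := by
  simp only [gaugeDist, gauge, mul, quartic, Prod.fst_neg, Prod.snd_neg]
  congr 1
  ring

theorem contDiff_quartic {n : WithTop ℕ∞} : ContDiff ℝ n (quartic ξ₀) := by
  unfold quartic; fun_prop

theorem contDiff_radialSq {n : WithTop ℕ∞} : ContDiff ℝ n (radialSq ξ₀) := by
  unfold radialSq; fun_prop

theorem quartic_nonneg (ξ : H1) : 0 ≤ quartic ξ₀ ξ := by unfold quartic; positivity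

theorem radialSq_nonneg (ξ : H1) : 0 ≤ radialSq ξ₀ ξ := by unfold radialSq; positivity

theorem quartic_eq_zero_iff {ξ : H1} : quartic ξ₀ ξ = 0 ↔ ξ = ξ₀ := by
  constructor
  · intro h
    have h1 := ((add_eq_zero_iff_of_nonneg (sq_nonneg _) (sq_nonneg _)).1 h).1
    have h2 := (add_eq_zero_iff_of_nonneg (sq_nonneg _) (sq_nonneg _)).1
      ((pow_eq_zero_iff two_ne_zero).1 h1)
    have hx : ξ.1 = ξ₀.1 := sub_eq_zero.1 ((pow_eq_zero_iff two_ne_zero).1 h2.1)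
    have hy : ξ.2.1 = ξ₀.2.1 := sub_eq_zero.1 ((pow_eq_zero_iff two_ne_zero).1 h2.2)
    have ht : ξ.2.2 = ξ₀.2.2 := by
      unfold quartic at h
      rw [hx, hy] at h
      have : (ξ.2.2 - ξ₀.2.2) ^ 2 = 0 := by
        rw [← h]; ring
      exact sub_eq_zero.1 ((pow_eq_zero_iff two_ne_zero).1 this)
    exact Prod.ext hx (Prod.ext hy ht)
  · rintro rfl
    simp [quartic]
    ring

theorem quartic_pos_iff {ξ : H1} : 0 < quartic ξ₀ ξ ↔ ξ ≠ ξ₀ := by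
  rw [(quartic_nonneg ξ₀ ξ).lt_iff_ne', Ne, quartic_eq_zero_iff]

theorem X_quartic : X (quartic ξ₀) = fun ξ ↦ 4 * (ξ.1 - ξ₀.1) * radialSq ξ₀ ξ +
    4 * (ξ.2.1 - ξ₀.2.1) * (ξ.2.2 - ξ₀.2.2 + 2 * (ξ.2.1 * ξ₀.1 - ξ.1 * ξ₀.2.1)) := by
  funext ξ
  unfold X quartic radialSq
  simp (disch := fun_prop) [fderiv_fun_add, fderiv_fun_sub, fderiv_fun_mul, fderiv_fun_pow,
    fderiv.fst, fderiv.snd]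
  ring

theorem Y_quartic : Y (quartic ξ₀) = fun ξ ↦ 4 * (ξ.2.1 - ξ₀.2.1) * radialSq ξ₀ ξ -
    4 * (ξ.1 - ξ₀.1) * (ξ.2.2 - ξ₀.2.2 + 2 * (ξ.2.1 * ξ₀.1 - ξ.1 * ξ₀.2.1)) := by
  funext ξ
  unfold Y quartic radialSq
  simp (disch := fun_prop) [fderiv_fun_add, fderiv_fun_sub, fderiv_fun_mul, fderiv_fun_pow,
    fderiv.fst, fderiv.snd]
  ring

theorem X_X_quartic (ξ : H1) : X (X (quartic ξ₀)) ξ = 12 * radialSq ξ₀ ξ := by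
  rw [X_quartic]
  unfold X radialSq
  simp (disch := fun_prop) [fderiv_fun_add, fderiv_fun_sub, fderiv_fun_mul, fderiv_fun_pow,
    fderiv.fst, fderiv.snd]
  ring

theorem Y_Y_quartic (ξ : H1) : Y (Y (quartic ξ₀)) ξ = 12 * radialSq ξ₀ ξ := by
  rw [Y_quartic]
  unfold Y radialSq
  simp (disch := fun_prop) [fderiv_fun_add, fderiv_fun_sub, fderiv_fun_mul, fderiv_fun_pow,
    fderiv.fst, fderiv.snd]
  ring

theorem mixed_quartic (ξ : H1) : mixed (quartic ξ₀) ξ = 0 := by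
  rw [mixed, X_quartic, Y_quartic]
  unfold X Y radialSq
  simp (disch := fun_prop) [fderiv_fun_add, fderiv_fun_sub, fderiv_fun_mul, fderiv_fun_pow,
    fderiv.fst, fderiv.snd]
  ring

/-- With 𝓗(q) = 12 r I, where r is `radialSq`, this makes 𝓗(q) equal to (3/4) |∇q|²/q times the
identity away from the centre, the relation behind the degeneracy of the cone. -/
theorem X_sq_add_Y_sq_quartic (ξ : H1) :
    X (quartic ξ₀) ξ ^ 2 + Y (quartic ξ₀) ξ ^ 2 = 16 * radialSq ξ₀ ξ * quartic ξ₀ ξ := by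
  rw [X_quartic, Y_quartic]
  unfold radialSq quartic
  ring

theorem X_radialSq : X (radialSq ξ₀) = fun ξ ↦ 2 * (ξ.1 - ξ₀.1) := by
  funext ξ
  unfold X radialSq
  simp (disch := fun_prop) [fderiv_fun_add, fderiv_fun_sub, fderiv_fun_pow,
    fderiv.fst, fderiv.snd]

theorem Y_radialSq : Y (radialSq ξ₀) = fun ξ ↦ 2 * (ξ.2.1 - ξ₀.2.1) := by
  funext ξ
  unfold Y radialSq
  simp (disch := fun_prop) [fderiv_fun_add, fderiv_fun_sub, fderiv_fun_pow,
    fderiv.fst, fderiv.snd]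

theorem X_X_radialSq (ξ : H1) : X (X (radialSq ξ₀)) ξ = 2 := by
  rw [X_radialSq]
  unfold X
  simp (disch := fun_prop) [fderiv_fun_sub, fderiv_fun_mul, fderiv.fst]

theorem Y_Y_radialSq (ξ : H1) : Y (Y (radialSq ξ₀)) ξ = 2 := by
  rw [Y_radialSq]
  unfold Y
  simp (disch := fun_prop) [fderiv_fun_sub, fderiv_fun_mul, fderiv.fst, fderiv.snd]

theorem mixed_radialSq (ξ : H1) : mixed (radialSq ξ₀) ξ = 0 := by
  rw [mixed, X_radialSq, Y_radialSq]
  unfold X Y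
  simp (disch := fun_prop) [fderiv_fun_sub, fderiv_fun_mul, fderiv.fst, fderiv.snd]

end Gauge

/-! ### Degeneracy of the horizontal Hessian of the cone. -/

section Cone

variable {ξ₀ : H1} {m R : ℝ}

/-- The horizontal Hessian of the cone `m (ρ / R - 1)` has rank at most one. -/
theorem horizontalHessian_cone {u : H1 → ℝ} (hm : 0 ≤ m) (hR : 0 < R)
    (hu : ∀ ξ, u ξ = m * (gaugeDist ξ ξ₀ / R - 1)) {ξ : H1} (hξ : ξ ≠ ξ₀) :
    ContDiffAt ℝ 2 u ξ ∧ ∃ a b : ℝ, X (X u) ξ = b ^ 2 ∧ mixed u ξ = -(a * b) ∧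
      Y (Y u) ξ = a ^ 2 := by
  set F : ℝ → ℝ := fun s ↦ m * (s ^ (1 / 4 : ℝ) / R - 1) with hF
  set G : ℝ → ℝ := fun s ↦ m / (4 * R) * s ^ (-3 / 4 : ℝ) with hG
  set q := quartic ξ₀ with hq
  have huF : u = fun ζ ↦ F (q ζ) := by
    funext ζ
    rw [hu, gaugeDist_eq]
  have hF' : ∀ s, 0 < s → HasDerivAt F (G s) s := by
    intro s hs
    have h := (((Real.hasDerivAt_rpow_const (p := 1 / 4) (Or.inl hs.ne')).div_const R).sub_const
      1).const_mul m
    refine h.congr_deriv ?_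
    simp only [hG]
    rw [show (1 / 4 - 1 : ℝ) = -3 / 4 by norm_num]
    field_simp
  -- For the power s^{1/4}, F'' = -(3/4) F'/s.
  have hG' : ∀ s, 0 < s → HasDerivAt G (-(3 / 4) * (G s / s)) s := by
    intro s hs
    have h := (Real.hasDerivAt_rpow_const (p := -3 / 4) (Or.inl hs.ne')).const_mul (m / (4 * R))
    refine h.congr_deriv ?_
    simp only [hG]
    rw [Real.rpow_sub_one hs.ne']
    ring
  have hqξ : 0 < q ξ := (quartic_pos_iff ξ₀).2 hξ
  have hqc : ∀ {n : WithTop ℕ∞}, ContDiff ℝ n q := contDiff_quartic ξ₀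
  have hpos : ∀ᶠ ζ in 𝓝 ξ, 0 < q ζ :=
    (hqc (n := 0)).continuous.continuousAt.eventually (lt_mem_nhds hqξ)
  have dq : ∀ ζ, DifferentiableAt ℝ q ζ := fun ζ ↦ (hqc (n := 1)).differentiable one_ne_zero ζ
  have hXu : X u =ᶠ[𝓝 ξ] fun ζ ↦ G (q ζ) * X q ζ := by
    filter_upwards [hpos] with ζ hζ
    rw [huF, X_comp (hF' _ hζ).differentiableAt (dq ζ), (hF' _ hζ).deriv]
  have hYu : Y u =ᶠ[𝓝 ξ] fun ζ ↦ G (q ζ) * Y q ζ := by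
    filter_upwards [hpos] with ζ hζ
    rw [huF, Y_comp (hF' _ hζ).differentiableAt (dq ζ), (hF' _ hζ).deriv]
  have dG := (hG' _ hqξ).differentiableAt
  have dGq : DifferentiableAt ℝ (fun ζ ↦ G (q ζ)) ξ := dG.comp ξ (dq ξ)
  have dX := (contDiff_one_X (hqc (n := 2))).differentiable one_ne_zero ξ
  have dY := (contDiff_one_Y (hqc (n := 2))).differentiable one_ne_zero ξ
  have hXG : X (fun ζ ↦ G (q ζ)) ξ = -(3 / 4) * (G (q ξ) / q ξ) * X q ξ := by
    rw [X_comp dG (dq ξ), (hG' _ hqξ).deriv]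
  have hYG : Y (fun ζ ↦ G (q ζ)) ξ = -(3 / 4) * (G (q ξ) / q ξ) * Y q ξ := by
    rw [Y_comp dG (dq ξ), (hG' _ hqξ).deriv]
  have hXX : X (X u) ξ = G (q ξ) * X (X q) ξ + X q ξ * (-(3 / 4) * (G (q ξ) / q ξ) * X q ξ) := by
    rw [(X_congr hXu).eq_of_nhds, X_mul dGq dX, hXG]
  have hYY : Y (Y u) ξ = G (q ξ) * Y (Y q) ξ + Y q ξ * (-(3 / 4) * (G (q ξ) / q ξ) * Y q ξ) := by
    rw [(Y_congr hYu).eq_of_nhds, Y_mul dGq dY, hYG]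
  have hXY : X (Y u) ξ = G (q ξ) * X (Y q) ξ + Y q ξ * (-(3 / 4) * (G (q ξ) / q ξ) * X q ξ) := by
    rw [(X_congr hYu).eq_of_nhds, X_mul dGq dY, hXG]
  have hYX : Y (X u) ξ = G (q ξ) * Y (X q) ξ + X q ξ * (-(3 / 4) * (G (q ξ) / q ξ) * Y q ξ) := by
    rw [(Y_congr hXu).eq_of_nhds, Y_mul dGq dX, hYG]
  have hG0 : 0 ≤ G (q ξ) := by positivity
  -- With this c, 𝓗(u) = c (|∇q|² I - ∇q ⊗ ∇q), which is c times the square of the rotated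
  -- horizontal gradient. Thus (a, b) = √c ∇q spans the null direction when nonzero.
  set c := 3 / 4 * (G (q ξ) / q ξ) with hc
  have hc0 : 0 ≤ c := by positivity
  have hGc : G (q ξ) = 4 / 3 * c * q ξ := by rw [hc]; field_simp
  have hs := X_sq_add_Y_sq_quartic ξ₀ ξ
  have hmx : X (Y q) ξ + Y (X q) ξ = 0 := by
    have := mixed_quartic ξ₀ ξ
    rw [mixed] at this
    linarith
  have hsc : √c * √c = c := Real.mul_self_sqrt hc0
  refine ⟨?_, √c * X q ξ, √c * Y q ξ, ?_, ?_, ?_⟩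
  · rw [huF]
    have : ContDiffAt ℝ 2 F (q ξ) :=
      contDiffAt_const.mul
        (((Real.contDiffAt_rpow_const_of_ne hqξ.ne').div_const R).sub contDiffAt_const)
    exact this.comp ξ hqc.contDiffAt
  · rw [hXX, X_X_quartic, mul_pow, sq √c, hsc]
    linear_combination (12 * radialSq ξ₀ ξ) * hGc - c * hs
  · rw [mixed, hXY, hYX]
    linear_combination (G (q ξ) / 2) * hmx + (X q ξ * Y q ξ) * hsc
  · rw [hYY, Y_Y_quartic, mul_pow, sq √c, hsc]
    linear_combination (12 * radialSq ξ₀ ξ) * hGc - c * hs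

end Cone

/-! ### Second-order condition at a local maximum. -/

section MaximumPrinciple

/-- At a local maximum the second derivative is nonpositive in every direction. -/
theorem fderiv_fderiv_nonpos_of_isLocalMax {E : Type*} [NormedAddCommGroup E] [NormedSpace ℝ E]
    {f : E → ℝ} {p : E} (hf : ContDiffAt ℝ 2 f p) (hmax : IsLocalMax f p) (e : E) :
    fderiv ℝ (fderiv ℝ f) p e e ≤ 0 := by
  by_contra! hpos
  set L : ℝ → E := fun s ↦ p + s • e with hL
  have hL0 : L 0 = p := by simp [hL]
  have hLd : ∀ s, HasDerivAt L e s := fun s ↦ by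
    simpa [hL] using ((hasDerivAt_id s).smul_const e).const_add p
  have hLc : Tendsto L (𝓝 0) (𝓝 p) := by
    have := (hLd 0).continuousAt.tendsto
    rwa [hL0] at this
  have hd : deriv (fun s ↦ f (L s)) =ᶠ[𝓝 0] fun s ↦ fderiv ℝ f (L s) e := by
    have h1 : ∀ᶠ ζ in 𝓝 p, DifferentiableAt ℝ f ζ :=
      (hf.eventually (by simp)).mono fun ζ h ↦ h.differentiableAt two_ne_zero
    filter_upwards [hLc.eventually h1] with s hs
    exact (hs.hasFDerivAt.comp_hasDerivAt s (hLd s)).deriv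
  have hdd : deriv (deriv fun s ↦ f (L s)) 0 = fderiv ℝ (fderiv ℝ f) p e e := by
    rw [hd.deriv_eq]
    have h2 : DifferentiableAt ℝ (fderiv ℝ f) (L 0) := by
      rw [hL0]
      exact (hf.fderiv_right (m := 1) (by norm_num)).differentiableAt one_ne_zero
    have h3 := (h2.hasFDerivAt.comp_hasDerivAt 0 (hLd 0)).clm_apply (hasDerivAt_const 0 e)
    have h4 : deriv (fun s ↦ fderiv ℝ f (L s) e) 0 = _ := h3.deriv
    rw [h4, hL0]
    simp
  have hd0 : deriv (fun s ↦ f (L s)) 0 = 0 := by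
    rw [hd.eq_of_nhds, hL0, hmax.fderiv_eq_zero]
    simp
  have hmax' : IsLocalMax (fun s ↦ f (L s)) 0 := by
    have := hLc.eventually hmax
    filter_upwards [this] with s hs
    rwa [hL0]
  have hcont : ContinuousAt (fun s ↦ f (L s)) 0 := by
    have : ContinuousAt f (L 0) := by rw [hL0]; exact hf.continuousAt
    exact this.comp (hLd 0).continuousAt
  -- A positive second derivative would make the point also a local minimum along the line; the
  -- function would then be locally constant there, with zero second derivative.
  have hmin := isLocalMin_of_deriv_deriv_pos (hdd ▸ hpos) hd0 hcont
  have hconst : (fun s ↦ f (L s)) =ᶠ[𝓝 0] fun _ ↦ f (L 0) := by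
    filter_upwards [hmin, hmax'] with s h1 h2
    exact le_antisymm h2 h1
  have : deriv (deriv fun s ↦ f (L s)) 0 = 0 := by
    rw [hconst.deriv.deriv_eq]
    simp
  rw [hdd] at this
  exact hpos.ne' this

end MaximumPrinciple

/-! ### Topology, compactness and convexity of gauge balls. -/

section BallGeometry

variable (ξ₀ : H1) (R : ℝ)

theorem continuous_gaugeDist : Continuous fun ξ ↦ gaugeDist ξ ξ₀ := by
  simp only [gaugeDist_eq]
  exact (contDiff_quartic ξ₀ (n := 0)).continuous.rpow_const fun _ ↦ Or.inr (by norm_num)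

theorem isOpen_gaugeBall : IsOpen (gaugeBall ξ₀ R) :=
  isOpen_lt (continuous_gaugeDist ξ₀) continuous_const

theorem gaugeDist_self : gaugeDist ξ₀ ξ₀ = 0 := by
  rw [gaugeDist_eq, (quartic_eq_zero_iff ξ₀).2 rfl, Real.zero_rpow (by norm_num)]

theorem gaugeDist_pos_iff {ξ : H1} : 0 < gaugeDist ξ ξ₀ ↔ ξ ≠ ξ₀ := by
  constructor
  · rintro h rfl
    rw [gaugeDist_self] at h
    exact h.false
  · intro h
    rw [gaugeDist_eq]
    exact Real.rpow_pos_of_pos ((quartic_pos_iff ξ₀).2 h) _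

theorem puncturedBall_eq : puncturedBall ξ₀ R = gaugeBall ξ₀ R \ {ξ₀} := by
  ext ξ
  simp only [puncturedBall, gaugeBall, Set.mem_ofPred_eq, gaugeDist_pos_iff, Set.mem_sdiff,
    Set.mem_singleton_iff]
  exact and_comm

theorem isOpen_puncturedBall : IsOpen (puncturedBall ξ₀ R) := by
  rw [puncturedBall_eq]
  exact (isOpen_gaugeBall ξ₀ R).sdiff isClosed_singleton

variable {R}

theorem gaugeDist_lt_iff (hR : 0 < R) {ξ : H1} : gaugeDist ξ ξ₀ < R ↔ quartic ξ₀ ξ < R ^ 4 := by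
  rw [gaugeDist_eq, one_div, Real.rpow_inv_lt_iff_of_pos (quartic_nonneg ξ₀ ξ) hR.le (by norm_num)]
  norm_cast

theorem gaugeDist_of_mem_frontier {ξ : H1} (hξ : ξ ∈ frontier (gaugeBall ξ₀ R)) :
    gaugeDist ξ ξ₀ = R :=
  frontier_lt_subset_eq (continuous_gaugeDist ξ₀) continuous_const hξ

theorem quartic_le_of_mem_closure (hR : 0 < R) {ξ : H1} (hξ : ξ ∈ closure (gaugeBall ξ₀ R)) :
    quartic ξ₀ ξ ≤ R ^ 4 := by
  have hc : IsClosed {ξ : H1 | quartic ξ₀ ξ ≤ R ^ 4} :=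
    isClosed_le (contDiff_quartic ξ₀ (n := 0)).continuous continuous_const
  exact closure_minimal (fun ζ hζ ↦ ((gaugeDist_lt_iff ξ₀ hR).1 hζ).le) hc hξ

theorem radialSq_le_of_mem_closure (hR : 0 < R) {ξ : H1} (hξ : ξ ∈ closure (gaugeBall ξ₀ R)) :
    radialSq ξ₀ ξ ≤ R ^ 2 := by
  have h := quartic_le_of_mem_closure ξ₀ hR hξ
  have h2 : radialSq ξ₀ ξ ^ 2 ≤ (R ^ 2) ^ 2 :=
    (le_add_of_nonneg_right (sq_nonneg _)).trans (h.trans (by ring_nf; rfl))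
  exact (sq_le_sq₀ (radialSq_nonneg ξ₀ ξ) (sq_nonneg R)).1 h2

theorem isCompact_closure_gaugeBall (hR : 0 < R) : IsCompact (closure (gaugeBall ξ₀ R)) := by
  set box : Set H1 := Set.Icc (-R) R ×ˢ Set.Icc (-R) R ×ˢ Set.Icc (-R ^ 2) (R ^ 2)
  have hbox : IsCompact box := isCompact_Icc.prod (isCompact_Icc.prod isCompact_Icc)
  have hm : Continuous (mul ξ₀) := by unfold mul; fun_prop
  refine (hbox.image hm).of_isClosed_subset isClosed_closure fun ξ hξ ↦ ?_
  refine ⟨mul (-ξ₀) ξ, ?_, ?_⟩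
  · have h1 := radialSq_le_of_mem_closure ξ₀ hR hξ
    have h2 := quartic_le_of_mem_closure ξ₀ hR hξ
    have hx : (ξ.1 - ξ₀.1) ^ 2 ≤ R ^ 2 := (le_add_of_nonneg_right (sq_nonneg _)).trans h1
    have hy : (ξ.2.1 - ξ₀.2.1) ^ 2 ≤ R ^ 2 := (le_add_of_nonneg_left (sq_nonneg _)).trans h1
    have ht : (ξ.2.2 - ξ₀.2.2 + 2 * (ξ.2.1 * ξ₀.1 - ξ.1 * ξ₀.2.1)) ^ 2 ≤ (R ^ 2) ^ 2 :=
      (le_add_of_nonneg_left (sq_nonneg _)).trans (h2.trans (by ring_nf; rfl))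
    have hx' := abs_le.1 (abs_le_of_sq_le_sq hx hR.le)
    have hy' := abs_le.1 (abs_le_of_sq_le_sq hy hR.le)
    have ht' := abs_le.1 (abs_le_of_sq_le_sq ht (sq_nonneg R))
    refine ⟨?_, ?_, ?_⟩ <;> simp only [mul, Prod.fst_neg, Prod.snd_neg, Set.mem_Icc] <;>
      constructor <;> linarith
  · simp only [mul, Prod.fst_neg, Prod.snd_neg]
    refine Prod.ext ?_ (Prod.ext ?_ ?_) <;> simp only <;> ring

/-- The coordinates of -ξ₀ ∘ ξ are affine in ξ, so `quartic` is built from squares of affine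
functions. Convexity serves only to give unique differentiability on the closed ball. -/
theorem convex_gaugeBall (hR : 0 < R) : Convex ℝ (gaugeBall ξ₀ R) := by
  have hsq : ConvexOn ℝ Set.univ fun s : ℝ ↦ s ^ 2 := even_two.convexOn_pow
  have haff : ∀ L : H1 →ᵃ[ℝ] ℝ, ConvexOn ℝ Set.univ fun ξ ↦ L ξ ^ 2 := fun L ↦
    hsq.comp_affineMap L
  have hx := haff (((LinearMap.fst ℝ ℝ (ℝ × ℝ)).toAffineMap) -
    AffineMap.const ℝ H1 ξ₀.1)
  have hy := haff (((LinearMap.fst ℝ ℝ ℝ ∘ₗ LinearMap.snd ℝ ℝ (ℝ × ℝ)).toAffineMap) -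
    AffineMap.const ℝ H1 ξ₀.2.1)
  have ht := haff (((LinearMap.snd ℝ ℝ ℝ ∘ₗ LinearMap.snd ℝ ℝ (ℝ × ℝ) +
    (2 * ξ₀.1) • (LinearMap.fst ℝ ℝ ℝ ∘ₗ LinearMap.snd ℝ ℝ (ℝ × ℝ)) -
    (2 * ξ₀.2.1) • LinearMap.fst ℝ ℝ (ℝ × ℝ)).toAffineMap) - AffineMap.const ℝ H1 ξ₀.2.2)
  have hq : ConvexOn ℝ Set.univ (quartic ξ₀) := by
    have h := ((hx.add hy).pow (fun ξ _ ↦ add_nonneg (sq_nonneg _) (sq_nonneg _)) 2).add ht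
    refine h.congr fun ξ _ ↦ ?_
    simp [quartic]
    ring
  have : gaugeBall ξ₀ R = {ξ ∈ Set.univ | quartic ξ₀ ξ < R ^ 4} := by
    ext ξ
    simp [gaugeBall, gaugeDist_lt_iff ξ₀ hR]
  rw [this]
  exact hq.convex_lt _

theorem self_mem_gaugeBall (hR : 0 < R) : ξ₀ ∈ gaugeBall ξ₀ R := by
  simpa [gaugeBall, gaugeDist_self] using hR

theorem uniqueDiffOn_closure_gaugeBall (hR : 0 < R) :
    UniqueDiffOn ℝ (closure (gaugeBall ξ₀ R)) :=
  uniqueDiffOn_convex (convex_gaugeBall ξ₀ hR).closure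
    ⟨ξ₀, interior_mono subset_closure
      ((isOpen_gaugeBall ξ₀ R).interior_eq.symm ▸ self_mem_gaugeBall ξ₀ hR)⟩

end BallGeometry

/-! ### Pointwise regularity and consequences of 𝓗-convexity. -/

section LocalRegularity

variable {f : H1 → ℝ} {ξ : H1}

theorem contDiffAt_X {n : ℕ} (hf : ContDiffAt ℝ (n + 1) f ξ) : ContDiffAt ℝ n (X f) ξ := by
  have h : ContDiffAt ℝ n (fderiv ℝ f) ξ := hf.fderiv_right le_rfl
  exact h.clm_apply (by fun_prop)

theorem contDiffAt_Y {n : ℕ} (hf : ContDiffAt ℝ (n + 1) f ξ) : ContDiffAt ℝ n (Y f) ξ := by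
  have h : ContDiffAt ℝ n (fderiv ℝ f) ξ := hf.fderiv_right le_rfl
  exact h.clm_apply (by fun_prop)

theorem contDiffAt_T {n : ℕ} (hf : ContDiffAt ℝ (n + 1) f ξ) : ContDiffAt ℝ n (T f) ξ := by
  have h : ContDiffAt ℝ n (fderiv ℝ f) ξ := hf.fderiv_right le_rfl
  exact h.clm_apply (by fun_prop)

theorem continuousAt_X_X (hf : ContDiffAt ℝ 2 f ξ) : ContinuousAt (X (X f)) ξ :=
  (contDiffAt_X (n := 0) (contDiffAt_X (n := 1) (by norm_num; exact hf))).continuousAt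

theorem continuousAt_mongeAmpere (hf : ContDiffAt ℝ 2 f ξ) : ContinuousAt (mongeAmpere f) ξ := by
  have hX : ContDiffAt ℝ ((0 : ℕ) + 1) (X f) ξ :=
    contDiffAt_X (n := 0 + 1) (by norm_num; exact hf)
  have hY : ContDiffAt ℝ ((0 : ℕ) + 1) (Y f) ξ :=
    contDiffAt_Y (n := 0 + 1) (by norm_num; exact hf)
  have h1 := (contDiffAt_X hX).continuousAt
  have h2 := (contDiffAt_Y hY).continuousAt
  have h3 := (contDiffAt_X hY).continuousAt
  have h4 := (contDiffAt_Y hX).continuousAt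
  have h5 := (contDiffAt_T (n := 1) (by norm_num; exact hf)).continuousAt
  have h : mongeAmpere f = fun ξ ↦ X (X f) ξ * Y (Y f) ξ - ((X (Y f) ξ + Y (X f) ξ) / 2) ^ 2 +
      12 * T f ξ ^ 2 := by
    funext ζ
    rw [mongeAmpere_eq, mixed]
  rw [h]
  fun_prop

end LocalRegularity

section Convexity

variable {Ω : Set H1} {f : H1 → ℝ} {ξ : H1}

theorem HConvexOn.quadratic_nonneg (hf : HConvexOn Ω f) (hξ : ξ ∈ Ω) (a b : ℝ) :
    0 ≤ a ^ 2 * X (X f) ξ + 2 * a * b * mixed f ξ + b ^ 2 * Y (Y f) ξ := by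
  have h := (hf.posSemidef ξ hξ).dotProduct_mulVec_nonneg ![a, b]
  simp [horizontalHessian, Matrix.mulVec, dotProduct, Fin.sum_univ_two] at h
  rw [mixed]
  linarith

theorem HConvexOn.mixed_sq_le (hf : HConvexOn Ω f) (hξ : ξ ∈ Ω) :
    mixed f ξ ^ 2 ≤ X (X f) ξ * Y (Y f) ξ := by
  have h := (hf.posSemidef ξ hξ).det_nonneg
  simp [horizontalHessian, Matrix.det_fin_two] at h
  rw [mixed]
  linarith

theorem HConvexOn.mongeAmpere_nonneg (hf : HConvexOn Ω f) (hξ : ξ ∈ Ω) : 0 ≤ mongeAmpere f ξ := by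
  rw [mongeAmpere_eq]
  nlinarith [hf.mixed_sq_le hξ, sq_nonneg (T f ξ)]

end Convexity

/-! ### The weak maximum principle along a horizontal direction. -/

section MaximumPrinciple

variable {ξ₀ : H1} {R : ℝ}

/-- The weak maximum principle for functions whose horizontal Hessian has, away from a set `Z` where
the sign is known, a direction in which it is nonnegative. -/
theorem nonpos_of_exists_direction (hR : 0 < R) {f : H1 → ℝ} {Z : Set H1}
    (hfc : ContinuousOn f (closure (gaugeBall ξ₀ R)))
    (hfr : ∀ ξ ∈ frontier (gaugeBall ξ₀ R), f ξ ≤ 0) (hZ : ∀ ξ ∈ Z, f ξ ≤ 0)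
    (hf : ∀ ξ ∈ gaugeBall ξ₀ R \ Z, ContDiffAt ℝ 2 f ξ ∧ ∃ a b : ℝ, 0 < a ^ 2 + b ^ 2 ∧
      0 ≤ a ^ 2 * X (X f) ξ + 2 * a * b * mixed f ξ + b ^ 2 * Y (Y f) ξ)
    {ξ : H1} (hξ : ξ ∈ closure (gaugeBall ξ₀ R)) : f ξ ≤ 0 := by
  have key : ∀ ε > 0, f ξ ≤ ε * R ^ 2 := by
    intro ε hε
    -- The perturbation has horizontal Hessian 2ε I, which makes the second derivative strictly
    -- positive in whichever direction the hypothesis supplies.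
    have hψc : ContinuousOn (fun ζ ↦ f ζ + ε * radialSq ξ₀ ζ) (closure (gaugeBall ξ₀ R)) :=
      hfc.add (continuousOn_const.mul (contDiff_radialSq ξ₀ (n := 0)).continuous.continuousOn)
    obtain ⟨p, hp, hmax⟩ := (isCompact_closure_gaugeBall ξ₀ hR).exists_isMaxOn ⟨ξ, hξ⟩ hψc
    have hpR := radialSq_le_of_mem_closure ξ₀ hR hp
    have hle : f ξ + ε * radialSq ξ₀ ξ ≤ f p + ε * radialSq ξ₀ p := hmax hξ
    have h0 := mul_nonneg hε.le (radialSq_nonneg ξ₀ ξ)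
    have h1 := mul_le_mul_of_nonneg_left hpR hε.le
    suffices f p ≤ 0 by linarith
    by_cases hpB : p ∈ gaugeBall ξ₀ R
    · by_cases hpZ : p ∈ Z
      · exact hZ p hpZ
      · exfalso
        obtain ⟨hfp, a, b, hab, hq⟩ := hf p ⟨hpB, hpZ⟩
        have hr : ContDiffAt ℝ 2 (radialSq ξ₀) p := (contDiff_radialSq ξ₀).contDiffAt
        have hloc : IsLocalMax (fun ζ ↦ f ζ + ε * radialSq ξ₀ ζ) p :=
          hmax.isLocalMax (mem_of_superset ((isOpen_gaugeBall ξ₀ R).mem_nhds hpB) subset_closure)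
        have hψ := contDiffAt_add_const_mul hfp hr ε
        have h2 := fderiv_fderiv_nonpos_of_isLocalMax hψ hloc
          (a, b, 2 * (a * p.2.1 - b * p.1))
        rw [fderiv_fderiv_horizontal hψ, X_X_add_const_mul hfp hr, mixed_add_const_mul hfp hr,
          Y_Y_add_const_mul hfp hr, X_X_radialSq, Y_Y_radialSq, mixed_radialSq] at h2
        nlinarith [mul_pos hε hab]
    · exact hfr p ⟨hp, by rwa [(isOpen_gaugeBall ξ₀ R).interior_eq]⟩
  by_contra! hpos
  have h := key (f ξ / (2 * R ^ 2)) (by positivity)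
  have : f ξ / (2 * R ^ 2) * R ^ 2 = f ξ / 2 := by field_simp
  linarith

end MaximumPrinciple

/-! ### Cutoffs in the values of w and in space. -/

section Cutoff

/-- A smooth nonincreasing function which vanishes on `[-δ, ∞)` and equals one on `(-∞, -2δ]`. -/
def smoothStep (δ s : ℝ) : ℝ := Real.smoothTransition (-s / δ - 1)

variable {δ : ℝ}

theorem contDiff_smoothStep : ContDiff ℝ 1 (smoothStep δ) :=
  (Real.smoothTransition.contDiff (n := 1)).comp (by fun_prop)

theorem smoothStep_nonneg (s : ℝ) : 0 ≤ smoothStep δ s := Real.smoothTransition.nonneg _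

theorem smoothStep_le_one (s : ℝ) : smoothStep δ s ≤ 1 := Real.smoothTransition.le_one _

theorem smoothStep_eq_zero (hδ : 0 < δ) {s : ℝ} (hs : -δ ≤ s) : smoothStep δ s = 0 := by
  refine Real.smoothTransition.zero_of_nonpos ?_
  rw [sub_nonpos, div_le_one hδ]
  linarith

theorem smoothStep_eq_one (hδ : 0 < δ) {s : ℝ} (hs : s ≤ -(2 * δ)) : smoothStep δ s = 1 := by
  refine Real.smoothTransition.one_of_one_le ?_
  rw [le_sub_iff_add_le, le_div_iff₀ hδ]
  linarith

theorem antitone_smoothStep (hδ : 0 < δ) : Antitone (smoothStep δ) := fun s t h ↦ by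
  refine Real.smoothTransition.monotone ?_
  gcongr

theorem deriv_smoothStep_nonpos (hδ : 0 < δ) (s : ℝ) : deriv (smoothStep δ) s ≤ 0 :=
  (antitone_smoothStep hδ).deriv_nonpos

theorem deriv_smoothStep_eq_zero (hδ : 0 < δ) {s : ℝ} (hs : -δ < s) :
    deriv (smoothStep δ) s = 0 := by
  have : smoothStep δ =ᶠ[𝓝 s] fun _ ↦ 0 := by
    filter_upwards [lt_mem_nhds hs] with r hr
    exact smoothStep_eq_zero hδ hr.le
  rw [this.deriv_eq, deriv_const]

theorem exists_contDiff_cutoff {E : Type*} [NormedAddCommGroup E] [NormedSpace ℝ E]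
    [FiniteDimensional ℝ E] {K U : Set E} (hK : IsCompact K) (hU : IsOpen U) (hKU : K ⊆ U) :
    ∃ χ : E → ℝ, ContDiff ℝ 2 χ ∧ HasCompactSupport χ ∧ tsupport χ ⊆ U ∧
      (∀ x ∈ K, χ =ᶠ[𝓝 x] fun _ ↦ 1) ∧ ∀ x, 0 ≤ χ x ∧ χ x ≤ 1 := by
  obtain ⟨L, hL, hKL, hLU⟩ := exists_compact_between hK hU hKU
  obtain ⟨χ, h1, h0, h01⟩ := exists_contMDiffMap_one_nhds_of_subset_interior (n := 2) 𝓘(ℝ, E)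
    hK.isClosed hKL
  have hsupp : tsupport (χ : E → ℝ) ⊆ L := closure_minimal
    (fun x hx ↦ by
      by_contra hxL
      exact hx (h0 x hxL)) hL.isClosed
  refine ⟨χ, χ.contMDiff.contDiff, hL.of_isClosed_subset (isClosed_tsupport _) hsupp,
    hsupp.trans hLU, fun x hx ↦ ?_, fun x ↦ h01 x⟩
  exact h1.filter_mono (nhds_le_nhdsSet hx)

theorem contDiff_mul_cutoff {E : Type*} [NormedAddCommGroup E] [NormedSpace ℝ E] {U : Set E}
    {χ f : E → ℝ} (hχ : ContDiff ℝ 2 χ) (hχU : tsupport χ ⊆ U)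
    (hf : ∀ x ∈ U, ContDiffAt ℝ 2 f x) : ContDiff ℝ 2 fun x ↦ χ x * f x := by
  rw [contDiff_iff_contDiffAt]
  intro x
  by_cases hx : x ∈ tsupport χ
  · exact hχ.contDiffAt.mul (hf x (hχU hx))
  · have : (fun x ↦ χ x * f x) =ᶠ[𝓝 x] fun _ ↦ 0 := by
      filter_upwards [notMem_tsupport_iff_eventuallyEq.1 hx] with y hy
      simp [hy]
    exact contDiffAt_const.congr_of_eventuallyEq this

end Cutoff

/-! ### The comparison principle. -/

section Comparison

variable {Ω : Set H1} {f g : H1 → ℝ}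

theorem HConvexOn.contDiffAt (hΩ : IsOpen Ω) (hf : HConvexOn Ω f) {ξ : H1} (hξ : ξ ∈ Ω) :
    ContDiffAt ℝ 2 f ξ :=
  hf.contDiffOn.contDiffAt (hΩ.mem_nhds hξ)

/-- Comparison of weighted integrals of `mongeAmpere` for compactly supported functions. -/
theorem integral_comp_mul_mongeAmpere_le {F G : H1 → ℝ} {η : ℝ → ℝ} (hF : ContDiff ℝ 2 F)
    (hG : ContDiff ℝ 2 G) (hFc : HasCompactSupport F) (hGc : HasCompactSupport G)
    (hη : ContDiff ℝ 1 η) (hη0 : η 0 = 0) (hη0' : deriv η 0 = 0)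
    (hcof : ∀ ξ, deriv η (F ξ + (-1) * G ξ) *
      cofactorForm (fun ξ ↦ F ξ + 1 * G ξ) (fun ξ ↦ F ξ + (-1) * G ξ) ξ ≤ 0) :
    Integrable (fun ξ ↦ η (F ξ + (-1) * G ξ) * mongeAmpere F ξ) ∧
      Integrable (fun ξ ↦ η (F ξ + (-1) * G ξ) * mongeAmpere G ξ) ∧
      ∫ ξ, η (F ξ + (-1) * G ξ) * mongeAmpere G ξ ≤
        ∫ ξ, η (F ξ + (-1) * G ξ) * mongeAmpere F ξ := by
  have hws : ContDiff ℝ 2 fun ξ ↦ F ξ + (-1) * G ξ := hF.add (contDiff_const.mul hG)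
  have hσs : ContDiff ℝ 2 fun ξ ↦ F ξ + 1 * G ξ := hF.add (contDiff_const.mul hG)
  have hwc : HasCompactSupport fun ξ ↦ F ξ + (-1) * G ξ := hFc.add hGc.mul_left
  have hσc : HasCompactSupport fun ξ ↦ F ξ + 1 * G ξ := hFc.add hGc.mul_left
  have hlin := integral_linearized hσs hσc hws hwc hη
  have hηw : Continuous fun ξ ↦ η (F ξ + (-1) * G ξ) := hη.continuous.comp hws.continuous
  have hηc : HasCompactSupport fun ξ ↦ η (F ξ + (-1) * G ξ) := hwc.comp_left hη0
  have hMF : Continuous (mongeAmpere F) := continuous_iff_continuousAt.2 fun ξ ↦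
    continuousAt_mongeAmpere hF.contDiffAt
  have hMG : Continuous (mongeAmpere G) := continuous_iff_continuousAt.2 fun ξ ↦
    continuousAt_mongeAmpere hG.contDiffAt
  have iF : Integrable fun ξ ↦ η (F ξ + (-1) * G ξ) * mongeAmpere F ξ :=
    (hηw.mul hMF).integrable_of_hasCompactSupport hηc.mul_right
  have iG : Integrable fun ξ ↦ η (F ξ + (-1) * G ξ) * mongeAmpere G ξ :=
    (hηw.mul hMG).integrable_of_hasCompactSupport hηc.mul_right
  refine ⟨iF, iG, ?_⟩
  have icof : Integrable fun ξ ↦ deriv η (F ξ + (-1) * G ξ) *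
      cofactorForm (fun ξ ↦ F ξ + 1 * G ξ) (fun ξ ↦ F ξ + (-1) * G ξ) ξ :=
    (((hη.continuous_deriv le_rfl).comp hws.continuous).mul
      (continuous_cofactorForm hσs hws)).integrable_of_hasCompactSupport
      (hwc.comp_left (g := deriv η) hη0').mul_right
  have h0 := integral_nonpos (μ := (volume : Measure H1)) hcof
  have h1 := integral_sub iF iG
  have h2 : ∫ ξ, (2 * (η (F ξ + (-1) * G ξ) * mongeAmpere F ξ -
      η (F ξ + (-1) * G ξ) * mongeAmpere G ξ) + deriv η (F ξ + (-1) * G ξ) *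
      cofactorForm (fun ξ ↦ F ξ + 1 * G ξ) (fun ξ ↦ F ξ + (-1) * G ξ) ξ) = 0 := by
    rw [← hlin]
    refine integral_congr_ae (Eventually.of_forall fun ξ ↦ ?_)
    simp only [linearized_add_sub (f := F) (g := G) (ξ := ξ) hF.contDiffAt hG.contDiffAt]
    ring
  have iS : Integrable fun ξ ↦ 2 * (η (F ξ + (-1) * G ξ) * mongeAmpere F ξ -
      η (F ξ + (-1) * G ξ) * mongeAmpere G ξ) := (iF.sub iG).const_mul 2
  rw [integral_add iS icof, integral_const_mul, h1] at h2
  linarith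

/-- The weight and its derivative live where f - g ≤ -δ, a compact set. Multiplying both functions
by a spatial cutoff equal to 1 near that set therefore reduces the claim to compact supports without
changing either integrand. -/
theorem lintegral_smoothStep_mul_mongeAmpere_le (hΩ : IsOpen Ω) (hf : HConvexOn Ω f)
    (hg : HConvexOn Ω g) (hfg : ∀ ξ ∈ Ω, f ξ ≤ g ξ) {δ : ℝ} (hδ : 0 < δ)
    (hK : IsCompact {ξ ∈ Ω | f ξ - g ξ ≤ -δ}) :
    ∫⁻ ξ in Ω, ENNReal.ofReal (smoothStep δ (f ξ - g ξ) * mongeAmpere g ξ) ≤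
      ∫⁻ ξ in Ω, ENNReal.ofReal (smoothStep δ (f ξ - g ξ) * mongeAmpere f ξ) := by
  set K := {ξ ∈ Ω | f ξ - g ξ ≤ -δ} with hKdef
  have hKΩ : K ⊆ Ω := fun ξ hξ ↦ hξ.1
  obtain ⟨χ, hχ, hχc, hχΩ, hχ1, hχ01⟩ := exists_contDiff_cutoff hK hΩ hKΩ
  set F : H1 → ℝ := fun ξ ↦ χ ξ * f ξ with hF
  set G : H1 → ℝ := fun ξ ↦ χ ξ * g ξ with hG
  have hFs : ContDiff ℝ 2 F := contDiff_mul_cutoff hχ hχΩ fun ξ hξ ↦ hf.contDiffAt hΩ hξ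
  have hGs : ContDiff ℝ 2 G := contDiff_mul_cutoff hχ hχΩ fun ξ hξ ↦ hg.contDiffAt hΩ hξ
  have hFc : HasCompactSupport F := hχc.mul_right
  have hGc : HasCompactSupport G := hχc.mul_right
  have hFf : ∀ ξ ∈ K, F =ᶠ[𝓝 ξ] f := fun ξ hξ ↦ by
    filter_upwards [hχ1 ξ hξ] with ζ hζ
    simp [hF, hζ]
  have hGg : ∀ ξ ∈ K, G =ᶠ[𝓝 ξ] g := fun ξ hξ ↦ by
    filter_upwards [hχ1 ξ hξ] with ζ hζ
    simp [hG, hζ]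
  have hw_eq : ∀ ξ, F ξ + (-1) * G ξ = χ ξ * (f ξ - g ξ) := fun ξ ↦ by
    simp only [hF, hG]; ring
  have hwK : ∀ ξ, F ξ + (-1) * G ξ ≤ -δ → ξ ∈ K := by
    intro ξ hξ
    rw [hw_eq] at hξ
    have hξΩ : ξ ∈ Ω := by
      refine hχΩ (subset_tsupport _ fun h0 ↦ ?_)
      rw [h0] at hξ
      linarith
    refine ⟨hξΩ, ?_⟩
    -- As 0 ≤ χ ≤ 1 and f - g ≤ 0, one has f - g ≤ χ(f - g) ≤ -δ: the cutoff creates no new points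
    -- in the sublevel set.
    nlinarith [hχ01 ξ, hfg ξ hξΩ]
  have hstepK : ∀ ξ, ξ ∉ K → smoothStep δ (F ξ + (-1) * G ξ) = 0 := fun ξ hξ ↦
    smoothStep_eq_zero hδ (not_lt.1 fun h ↦ hξ (hwK ξ h.le))
  obtain ⟨iF, iG, hint⟩ := integral_comp_mul_mongeAmpere_le hFs hGs hFc hGc
    (contDiff_smoothStep (δ := δ)) (smoothStep_eq_zero hδ (by linarith))
    (deriv_smoothStep_eq_zero hδ (by linarith)) fun ξ ↦ by
      by_cases hξ : ξ ∈ K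
      · refine mul_nonpos_of_nonpos_of_nonneg (deriv_smoothStep_nonpos hδ _) ?_
        generalize (fun ξ ↦ F ξ + (-1) * G ξ) = w
        -- The cofactor form at (Xw, Yw) is the Hessian form at the rotated vector (Yw, -Xw).
        have q1 := hf.quadratic_nonneg (hKΩ hξ) (Y w ξ) (-X w ξ)
        have q2 := hg.quadratic_nonneg (hKΩ hξ) (Y w ξ) (-X w ξ)
        have hFA : ContDiffAt ℝ 2 F ξ := hFs.contDiffAt
        have hGA : ContDiffAt ℝ 2 G ξ := hGs.contDiffAt
        rw [cofactorForm, X_X_add_const_mul hFA hGA, Y_Y_add_const_mul hFA hGA,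
          mixed_add_const_mul hFA hGA, (X_congr (X_congr (hFf ξ hξ))).eq_of_nhds,
          (X_congr (X_congr (hGg ξ hξ))).eq_of_nhds, (Y_congr (Y_congr (hFf ξ hξ))).eq_of_nhds,
          (Y_congr (Y_congr (hGg ξ hξ))).eq_of_nhds, mixed_congr (hFf ξ hξ),
          mixed_congr (hGg ξ hξ)]
        linarith
      · rw [deriv_smoothStep_eq_zero hδ (not_le.1 fun h ↦ hξ (hwK ξ h)), zero_mul]
  have hpt : ∀ ξ ∈ Ω, smoothStep δ (f ξ - g ξ) = smoothStep δ (F ξ + (-1) * G ξ) := by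
    intro ξ hξ
    by_cases hξK : ξ ∈ K
    · rw [hw_eq, (hχ1 ξ hξK).eq_of_nhds, one_mul]
    · rw [hstepK ξ hξK]
      exact smoothStep_eq_zero hδ (not_lt.1 fun h ↦ hξK ⟨hξ, h.le⟩)
  have hptF : ∀ ξ, smoothStep δ (F ξ + (-1) * G ξ) * mongeAmpere F ξ = smoothStep δ (F ξ + (-1) * G ξ) * mongeAmpere f ξ := fun ξ ↦ by
    by_cases hξK : ξ ∈ K
    · rw [mongeAmpere_congr (hFf ξ hξK)]
    · rw [hstepK ξ hξK, zero_mul, zero_mul]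
  have hptG : ∀ ξ, smoothStep δ (F ξ + (-1) * G ξ) * mongeAmpere G ξ = smoothStep δ (F ξ + (-1) * G ξ) * mongeAmpere g ξ := fun ξ ↦ by
    by_cases hξK : ξ ∈ K
    · rw [mongeAmpere_congr (hGg ξ hξK)]
    · rw [hstepK ξ hξK, zero_mul, zero_mul]
  simp only [hptF] at hint iF
  simp only [hptG] at hint iG
  have nF : ∀ ξ, 0 ≤ smoothStep δ (F ξ + (-1) * G ξ) * mongeAmpere f ξ := fun ξ ↦ by
    by_cases hξK : ξ ∈ K
    · exact mul_nonneg (smoothStep_nonneg _) (hf.mongeAmpere_nonneg (hKΩ hξK))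
    · rw [hstepK ξ hξK, zero_mul]
  have nG : ∀ ξ, 0 ≤ smoothStep δ (F ξ + (-1) * G ξ) * mongeAmpere g ξ := fun ξ ↦ by
    by_cases hξK : ξ ∈ K
    · exact mul_nonneg (smoothStep_nonneg _) (hg.mongeAmpere_nonneg (hKΩ hξK))
    · rw [hstepK ξ hξK, zero_mul]
  have hl := ENNReal.ofReal_le_ofReal hint
  rw [ofReal_integral_eq_lintegral_ofReal iG (Eventually.of_forall nG),
    ofReal_integral_eq_lintegral_ofReal iF (Eventually.of_forall nF)] at hl
  calc ∫⁻ ξ in Ω, ENNReal.ofReal (smoothStep δ (f ξ - g ξ) * mongeAmpere g ξ)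
      = ∫⁻ ξ in Ω, ENNReal.ofReal (smoothStep δ (F ξ + (-1) * G ξ) * mongeAmpere g ξ) :=
        setLIntegral_congr_fun hΩ.measurableSet fun ξ hξ ↦ by simp only [hpt ξ hξ]
    _ ≤ ∫⁻ ξ, ENNReal.ofReal (smoothStep δ (F ξ + (-1) * G ξ) * mongeAmpere g ξ) := setLIntegral_le_lintegral _ _
    _ ≤ ∫⁻ ξ, ENNReal.ofReal (smoothStep δ (F ξ + (-1) * G ξ) * mongeAmpere f ξ) := hl
    _ = ∫⁻ ξ in Ω, ENNReal.ofReal (smoothStep δ (F ξ + (-1) * G ξ) * mongeAmpere f ξ) := by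
        refine (setLIntegral_eq_of_support_subset fun ξ hξ ↦ ?_).symm
        by_contra hξΩ
        exact hξ (by simp only [hstepK ξ fun h ↦ hξΩ (hKΩ h), zero_mul, ENNReal.ofReal_zero])
    _ = ∫⁻ ξ in Ω, ENNReal.ofReal (smoothStep δ (f ξ - g ξ) * mongeAmpere f ξ) :=
        setLIntegral_congr_fun hΩ.measurableSet fun ξ hξ ↦ by simp only [hpt ξ hξ]

/-- The comparison principle for the operator `mongeAmpere`, when the larger of the two functions
has a degenerate horizontal Hessian. -/
theorem lintegral_mongeAmpere_le (hΩ : IsOpen Ω) (hf : HConvexOn Ω f) (hg : HConvexOn Ω g)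
    (hfg : ∀ ξ ∈ Ω, f ξ ≤ g ξ) (hK : ∀ δ > 0, IsCompact {ξ ∈ Ω | f ξ - g ξ ≤ -δ})
    (hdet : ∀ ξ ∈ Ω, X (X g) ξ * Y (Y g) ξ = mixed g ξ ^ 2) :
    ∫⁻ ξ in Ω, ENNReal.ofReal (mongeAmpere g ξ) ≤
      ∫⁻ ξ in Ω, ENNReal.ofReal (mongeAmpere f ξ) := by
  have hfc : ContinuousOn f Ω := hf.contDiffOn.continuousOn
  have hgc : ContinuousOn g Ω := hg.contDiffOn.continuousOn
  have hwc : ContinuousOn (fun ξ ↦ f ξ - g ξ) Ω := hfc.sub hgc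
  have hMg : ContinuousOn (mongeAmpere g) Ω := fun ξ hξ ↦
    (continuousAt_mongeAmpere (hg.contDiffAt hΩ hξ)).continuousWithinAt
  set N := Ω ∩ (fun ξ ↦ f ξ - g ξ) ⁻¹' Set.Iio 0 with hN
  have hNo : IsOpen N := hwc.isOpen_inter_preimage hΩ isOpen_Iio
  have hNΩ : N ⊆ Ω := Set.inter_subset_left
  have hneg : ∫⁻ ξ in N, ENNReal.ofReal (mongeAmpere g ξ) ≤
      ∫⁻ ξ in N, ENNReal.ofReal (mongeAmpere f ξ) := by
    set d : ℕ → ℝ := fun n ↦ 1 / ((n : ℝ) + 1) with hd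
    have hd0 : ∀ n, 0 < d n := fun n ↦ by positivity
    have hdlim : Tendsto d atTop (𝓝 0) := tendsto_one_div_add_atTop_nhds_zero_nat
    set φ : ℕ → H1 → ℝ≥0∞ := fun n ξ ↦
      ENNReal.ofReal (smoothStep (d n) (f ξ - g ξ) * mongeAmpere g ξ) with hφ
    have hmeas : ∀ n, AEMeasurable (φ n) (volume.restrict N) := fun n ↦ by
      have : ContinuousOn (fun ξ ↦ smoothStep (d n) (f ξ - g ξ) * mongeAmpere g ξ) N :=
        ((contDiff_smoothStep.continuous.comp_continuousOn hwc).mul hMg).mono hNΩ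
      exact (this.aemeasurable hNo.measurableSet).ennreal_ofReal
    have hlim : ∀ ξ ∈ N, ENNReal.ofReal (mongeAmpere g ξ) = liminf (fun n ↦ φ n ξ) atTop := by
      intro ξ hξ
      have hξ0 : f ξ - g ξ < 0 := hξ.2
      refine (Tendsto.liminf_eq (tendsto_const_nhds.congr' ?_)).symm
      filter_upwards [hdlim.eventually (gt_mem_nhds (show 0 < -(f ξ - g ξ) / 2 by linarith))]
        with n hn
      simp only [hφ]
      rw [smoothStep_eq_one (hd0 n) (by linarith), one_mul]
    have hbound : ∀ n, ∫⁻ ξ in N, φ n ξ ≤ ∫⁻ ξ in N, ENNReal.ofReal (mongeAmpere f ξ) := by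
      intro n
      -- Enlarge N to Ω, compare there, and return to N: the weight vanishes where f = g and is at
      -- most 1 elsewhere.
      refine (lintegral_mono_set hNΩ).trans
        ((lintegral_smoothStep_mul_mongeAmpere_le hΩ hf hg hfg (hd0 n) (hK _ (hd0 n))).trans ?_)
      rw [← lintegral_indicator hΩ.measurableSet, ← lintegral_indicator hNo.measurableSet]
      refine lintegral_mono fun ξ ↦ ?_
      by_cases hξ : ξ ∈ N
      · rw [Set.indicator_of_mem hξ, Set.indicator_of_mem (hNΩ hξ)]
        exact ENNReal.ofReal_le_ofReal
          (mul_le_of_le_one_left (hf.mongeAmpere_nonneg (hNΩ hξ)) (smoothStep_le_one _))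
      · rw [Set.indicator_of_notMem hξ]
        by_cases hξΩ : ξ ∈ Ω
        · have h0 : 0 ≤ f ξ - g ξ := not_lt.1 fun h ↦ hξ ⟨hξΩ, h⟩
          rw [Set.indicator_of_mem hξΩ,
            smoothStep_eq_zero (hd0 n) (by linarith [hd0 n])]
          simp
        · rw [Set.indicator_of_notMem hξΩ]
    calc ∫⁻ ξ in N, ENNReal.ofReal (mongeAmpere g ξ)
        = ∫⁻ ξ in N, liminf (fun n ↦ φ n ξ) atTop :=
          setLIntegral_congr_fun hNo.measurableSet hlim
      _ ≤ liminf (fun n ↦ ∫⁻ ξ in N, φ n ξ) atTop := lintegral_liminf_le' hmeas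
      _ ≤ liminf (fun _ : ℕ ↦ ∫⁻ ξ in N, ENNReal.ofReal (mongeAmpere f ξ)) atTop :=
          liminf_le_liminf (Eventually.of_forall hbound)
      _ = _ := liminf_const _
  have hcontact : ∫⁻ ξ in Ω \ N, ENNReal.ofReal (mongeAmpere g ξ) ≤
      ∫⁻ ξ in Ω \ N, ENNReal.ofReal (mongeAmpere f ξ) := by
    refine setLIntegral_mono' (hΩ.measurableSet.diff hNo.measurableSet) fun ξ hξ ↦ ?_
    refine ENNReal.ofReal_le_ofReal ?_
    have hξ0 : f ξ - g ξ = 0 :=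
      le_antisymm (sub_nonpos.2 (hfg ξ hξ.1)) (not_lt.1 fun h ↦ hξ.2 ⟨hξ.1, h⟩)
    -- At a contact point f - g attains its maximum 0 inside Ω, so the gradients agree. The ∂_t
    -- terms are then equal and only the determinants remain, that of g being zero.
    have hmax : IsLocalMax (fun ζ ↦ f ζ - g ζ) ξ := by
      filter_upwards [hΩ.mem_nhds hξ.1] with ζ hζ
      rw [hξ0]
      exact sub_nonpos.2 (hfg ζ hζ)
    have hfd := (hf.contDiffAt hΩ hξ.1).differentiableAt two_ne_zero
    have hgd := (hg.contDiffAt hΩ hξ.1).differentiableAt two_ne_zero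
    have hfd0 : fderiv ℝ f ξ = fderiv ℝ g ξ := by
      have := hmax.fderiv_eq_zero
      rwa [fderiv_fun_sub hfd hgd, sub_eq_zero] at this
    have hT : T f ξ = T g ξ := by simp only [T, hfd0]
    rw [mongeAmpere_eq, mongeAmpere_eq, hT, hdet ξ hξ.1]
    linarith [hf.mixed_sq_le hξ.1]
  have hs := fun h : H1 → ℝ≥0∞ ↦ lintegral_inter_add_sdiff h Ω hNo.measurableSet (μ := volume)
  have hΩN : Ω ∩ N = N := Set.inter_eq_right.2 hNΩ
  simp only [hΩN] at hs
  rw [← hs, ← hs]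
  exact add_le_add hneg hcontact

end Comparison

/-! ### Application to v and the cone. -/

section Main

variable {ξ₀ : H1} {R : ℝ} {v : H1 → ℝ}

theorem contDiffAt_of_mem_gaugeBall (hv : ContDiffOn ℝ 2 v (closure (gaugeBall ξ₀ R))) {ξ : H1}
    (hξ : ξ ∈ gaugeBall ξ₀ R) : ContDiffAt ℝ 2 v ξ :=
  hv.contDiffAt (mem_of_superset ((isOpen_gaugeBall ξ₀ R).mem_nhds hξ) subset_closure)

/-- For a function of class `C²` up to the boundary the operator `mongeAmpere` is integrable. -/
theorem integrableOn_mongeAmpere (hR : 0 < R)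
    (hv : ContDiffOn ℝ 2 v (closure (gaugeBall ξ₀ R))) :
    IntegrableOn (mongeAmpere v) (gaugeBall ξ₀ R) volume := by
  set K := closure (gaugeBall ξ₀ R) with hK
  have hu : UniqueDiffOn ℝ K := uniqueDiffOn_closure_gaugeBall ξ₀ hR
  -- Derivatives within the closed ball are continuous up to the boundary, hence bounded on a
  -- compact set; inside the ball they are the ordinary ones.
  set D1 := fderivWithin ℝ v K with hD1
  set D2 := fderivWithin ℝ D1 K with hD2
  have h1 : ContDiffOn ℝ 1 D1 K := hv.fderivWithin hu (by norm_num)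
  have c1 : ContinuousOn D1 K := h1.continuousOn
  have c2 : ContinuousOn D2 K := h1.continuousOn_fderivWithin hu le_rfl
  set eX : H1 → H1 := fun ξ ↦ (1, 0, 2 * ξ.2.1) with heX
  set eY : H1 → H1 := fun ξ ↦ (0, 1, -2 * ξ.1) with heY
  have cX : ContinuousOn eX K := by fun_prop
  have cY : ContinuousOn eY K := by fun_prop
  have hc : ContinuousOn (fun ξ ↦ D2 ξ (eX ξ) (eX ξ) * D2 ξ (eY ξ) (eY ξ) -
      D2 ξ (eX ξ) (eY ξ) ^ 2 + 12 * D1 ξ (0, 0, 1) ^ 2) K := by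
    have a1 := (c2.clm_apply cX).clm_apply cX
    have a2 := (c2.clm_apply cY).clm_apply cY
    have a3 := (c2.clm_apply cX).clm_apply cY
    have a4 : ContinuousOn (fun ξ ↦ D1 ξ (0, 0, 1)) K := c1.clm_apply continuousOn_const
    exact ((a1.mul a2).sub (a3.pow 2)).add (continuousOn_const.mul (a4.pow 2))
  have hi := (hc.integrableOn_compact (isCompact_closure_gaugeBall ξ₀ hR)
    (μ := volume)).mono_set subset_closure
  refine hi.congr_fun (fun ξ hξ ↦ ?_) (isOpen_gaugeBall ξ₀ R).measurableSet
  have hd1 : D1 =ᶠ[𝓝 ξ] fderiv ℝ v := by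
    filter_upwards [(isOpen_gaugeBall ξ₀ R).mem_nhds hξ] with ζ hζ
    exact fderivWithin_of_mem_nhds
      (mem_of_superset ((isOpen_gaugeBall ξ₀ R).mem_nhds hζ) subset_closure)
  have hd2 : D2 ξ = fderiv ℝ (fderiv ℝ v) ξ := by
    rw [hD2, fderivWithin_of_mem_nhds
      (mem_of_superset ((isOpen_gaugeBall ξ₀ R).mem_nhds hξ) subset_closure), hd1.fderiv_eq]
  have hvξ := contDiffAt_of_mem_gaugeBall hv hξ
  simp only [hd2, hd1.eq_of_nhds]
  rw [mongeAmpere_eq, X_X_eq hvξ, Y_Y_eq hvξ, mixed_eq hvξ, T]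

theorem nonpos_of_hConvexOn (hR : 0 < R) (hv : ContDiffOn ℝ 2 v (closure (gaugeBall ξ₀ R)))
    (hconv : HConvexOn (puncturedBall ξ₀ R) v)
    (hbdry : ∀ ξ ∈ frontier (gaugeBall ξ₀ R), v ξ = 0) {ξ : H1}
    (hξ : ξ ∈ closure (gaugeBall ξ₀ R)) : v ξ ≤ 0 := by
  rw [puncturedBall_eq] at hconv
  have hXX : ∀ ζ ∈ gaugeBall ξ₀ R \ {ξ₀}, 0 ≤ X (X v) ζ := fun ζ hζ ↦ by
    simpa using hconv.quadratic_nonneg hζ 1 0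
  refine nonpos_of_exists_direction hR (Z := ∅) hv.continuousOn (fun ζ hζ ↦ (hbdry ζ hζ).le)
    (by simp) (fun ζ hζ ↦ ⟨contDiffAt_of_mem_gaugeBall hv hζ.1, 1, 0, by norm_num, ?_⟩) hξ
  suffices 0 ≤ X (X v) ζ by simpa using this
  -- Convexity is assumed off the centre only; there X²v ≥ 0 follows by continuity.
  by_cases hζ0 : ζ = ξ₀
  · subst hζ0
    have hc := continuousAt_X_X (contDiffAt_of_mem_gaugeBall hv hζ.1)
    have ht : Tendsto (X (X v)) (𝓝[≠] ζ) (𝓝 (X (X v) ζ)) := hc.tendsto.mono_left nhdsWithin_le_nhds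
    refine ge_of_tendsto ht ?_
    filter_upwards [self_mem_nhdsWithin,
      nhdsWithin_le_nhds ((isOpen_gaugeBall ζ R).mem_nhds hζ.1)] with p hp hpB
    exact hXX p ⟨hpB, hp⟩
  · exact hXX ζ ⟨hζ.1, hζ0⟩

theorem hConvexOn_cone {u : H1 → ℝ} {m : ℝ} (hm : 0 ≤ m) (hR : 0 < R)
    (hu : ∀ ξ, u ξ = m * (gaugeDist ξ ξ₀ / R - 1)) : HConvexOn {ξ₀}ᶜ u where
  contDiffOn := fun _ hξ ↦ (horizontalHessian_cone hm hR hu hξ).1.contDiffWithinAt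
  posSemidef := fun ξ hξ ↦ by
    obtain ⟨-, a, b, h1, h2, h3⟩ := horizontalHessian_cone hm hR hu hξ
    have h : horizontalHessian u ξ = Matrix.vecMulVec ![b, -a] (star ![b, -a]) := by
      rw [mixed] at h2
      ext i j
      fin_cases i <;> fin_cases j <;>
        simp [horizontalHessian, h1, h2, h3, Matrix.vecMulVec_apply] <;> ring
    rw [h]
    exact Matrix.posSemidef_vecMulVec_self_star _

theorem HConvexOn.mono {Ω Ω' : Set H1} {f : H1 → ℝ} (hf : HConvexOn Ω f) (h : Ω' ⊆ Ω) :
    HConvexOn Ω' f :=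
  ⟨hf.contDiffOn.mono h, fun ξ hξ ↦ hf.posSemidef ξ (h hξ)⟩

end Main

end Heisenberg

end

open Heisenberg in
theorem theorem4p7 (ξ₀ : Heisenberg.H1) (R : ℝ) (hR : 0 < R)
    (v : Heisenberg.H1 → ℝ)
    (hv : ContDiffOn ℝ 2 v (closure (Heisenberg.gaugeBall ξ₀ R)))
    (hconv : Heisenberg.HConvexOn (Heisenberg.puncturedBall ξ₀ R) v)
    (hbdry : ∀ ξ ∈ frontier (Heisenberg.gaugeBall ξ₀ R), v ξ = 0)
    (u : Heisenberg.H1 → ℝ)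
    (hu : ∀ ξ, u ξ = -v ξ₀ * (Heisenberg.gaugeDist ξ ξ₀ / R - 1)) :
    IntegrableOn (Heisenberg.mongeAmpere u) (Heisenberg.gaugeBall ξ₀ R) volume ∧
      IntegrableOn (Heisenberg.mongeAmpere v) (Heisenberg.gaugeBall ξ₀ R) volume ∧
      ∫ ξ in Heisenberg.gaugeBall ξ₀ R, Heisenberg.mongeAmpere u ξ ≤
        ∫ ξ in Heisenberg.gaugeBall ξ₀ R, Heisenberg.mongeAmpere v ξ := by
  have hm : 0 ≤ -v ξ₀ := neg_nonneg.2
    (nonpos_of_hConvexOn hR hv hconv hbdry (subset_closure (self_mem_gaugeBall ξ₀ hR)))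
  have hΩo := isOpen_puncturedBall ξ₀ R
  have hΩB := puncturedBall_eq ξ₀ R
  have hΩ0 : puncturedBall ξ₀ R ⊆ {ξ₀}ᶜ := fun ξ hξ ↦ (gaugeDist_pos_iff ξ₀).1 hξ.1
  have huconv : HConvexOn (puncturedBall ξ₀ R) u := (hConvexOn_cone hm hR hu).mono hΩ0
  have huc : Continuous u := by
    have := continuous_gaugeDist ξ₀
    rw [show u = fun ξ ↦ -v ξ₀ * (gaugeDist ξ ξ₀ / R - 1) from funext hu]
    fun_prop
  have hu0 : u ξ₀ = v ξ₀ := by rw [hu, gaugeDist_self]; simp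
  have hur : ∀ ξ ∈ frontier (gaugeBall ξ₀ R), u ξ = 0 := fun ξ hξ ↦ by
    rw [hu, gaugeDist_of_mem_frontier ξ₀ hξ, div_self hR.ne', sub_self, mul_zero]
  have hwc : ContinuousOn (fun ξ ↦ v ξ - u ξ) (closure (gaugeBall ξ₀ R)) :=
    hv.continuousOn.sub huc.continuousOn
  have hvu : ∀ ξ ∈ puncturedBall ξ₀ R, v ξ ≤ u ξ := by
    intro ξ hξ
    have h := nonpos_of_exists_direction hR (f := fun ζ ↦ v ζ + (-1) * u ζ) (Z := {ξ₀})
      (hv.continuousOn.add (continuousOn_const.mul huc.continuousOn))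
      (fun ζ hζ ↦ by simp [hbdry ζ hζ, hur ζ hζ]) (fun ζ hζ ↦ by
        rw [Set.mem_singleton_iff.1 hζ, hu0]; linarith)
      (fun ζ hζ ↦ ?_) (subset_closure hξ.2)
    · linarith
    · rw [← hΩB] at hζ
      obtain ⟨huζ, a, b, h1, h2, h3⟩ := horizontalHessian_cone hm hR hu (hΩ0 hζ)
      have hvζ := hconv.contDiffAt hΩo hζ
      refine ⟨contDiffAt_add_const_mul hvζ huζ _, ?_⟩
      simp only [X_X_add_const_mul hvζ huζ, Y_Y_add_const_mul hvζ huζ,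
        mixed_add_const_mul hvζ huζ, h1, h2, h3]
      -- Along (a, b) the Hessian of the cone vanishes, so only the nonnegative contribution of v
      -- remains. If a = b = 0 the whole Hessian of the cone is zero and any direction serves.
      rcases (add_nonneg (sq_nonneg a) (sq_nonneg b)).lt_or_eq with hab | hab
      · exact ⟨a, b, hab, by linarith [hconv.quadratic_nonneg hζ a b]⟩
      · refine ⟨1, 0, by norm_num, ?_⟩
        have hb : b ^ 2 = 0 := by linarith [sq_nonneg a, sq_nonneg b]
        linarith [hconv.quadratic_nonneg hζ 1 0]
  have hK : ∀ δ > 0, IsCompact {ξ ∈ puncturedBall ξ₀ R | v ξ - u ξ ≤ -δ} := by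
    intro δ hδ
    -- Since v - u vanishes on the sphere and at the centre, the sublevel set avoids both and is
    -- closed in the compact closed ball.
    have h : {ξ ∈ puncturedBall ξ₀ R | v ξ - u ξ ≤ -δ} =
        closure (gaugeBall ξ₀ R) ∩ (fun ξ ↦ v ξ - u ξ) ⁻¹' Set.Iic (-δ) := by
      ext ξ
      refine ⟨fun hξ ↦ ⟨subset_closure hξ.1.2, hξ.2⟩, fun hξ ↦ ⟨?_, hξ.2⟩⟩
      have hξδ : v ξ - u ξ ≤ -δ := hξ.2
      rw [hΩB]
      refine ⟨?_, ?_⟩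
      · by_contra hξB
        have hfr : ξ ∈ frontier (gaugeBall ξ₀ R) :=
          ⟨hξ.1, by rwa [(isOpen_gaugeBall ξ₀ R).interior_eq]⟩
        rw [hbdry ξ hfr, hur ξ hfr] at hξδ
        linarith
      · intro h0
        rw [Set.mem_singleton_iff.1 h0, hu0] at hξδ
        linarith
    rw [h]
    exact (isCompact_closure_gaugeBall ξ₀ hR).of_isClosed_subset
      (hwc.preimage_isClosed_of_isClosed isClosed_closure isClosed_Iic) Set.inter_subset_left
  have hdet : ∀ ξ ∈ puncturedBall ξ₀ R, X (X u) ξ * Y (Y u) ξ = mixed u ξ ^ 2 := by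
    intro ξ hξ
    obtain ⟨-, a, b, h1, h2, h3⟩ := horizontalHessian_cone hm hR hu (hΩ0 hξ)
    rw [h1, h2, h3]
    ring
  have hle := lintegral_mongeAmpere_le hΩo hconv huconv hvu hK hdet
  have hiv := integrableOn_mongeAmpere hR hv
  have hae : puncturedBall ξ₀ R =ᵐ[volume] gaugeBall ξ₀ R := by
    rw [hΩB]
    exact sdiff_null_ae_eq_self (measure_singleton _)
  have hivΩ : IntegrableOn (mongeAmpere v) (puncturedBall ξ₀ R) volume :=
    hiv.congr_set_ae hae
  have nv : 0 ≤ᵐ[volume.restrict (puncturedBall ξ₀ R)] mongeAmpere v :=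
    ae_restrict_of_forall_mem hΩo.measurableSet fun ξ hξ ↦ hconv.mongeAmpere_nonneg hξ
  have nu : 0 ≤ᵐ[volume.restrict (puncturedBall ξ₀ R)] mongeAmpere u :=
    ae_restrict_of_forall_mem hΩo.measurableSet fun ξ hξ ↦ huconv.mongeAmpere_nonneg hξ
  have mu : AEStronglyMeasurable (mongeAmpere u) (volume.restrict (puncturedBall ξ₀ R)) :=
    ContinuousOn.aestronglyMeasurable (fun ξ hξ ↦ (continuousAt_mongeAmpere
      (huconv.contDiffAt hΩo hξ)).continuousWithinAt) hΩo.measurableSet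
  have hfin := (hasFiniteIntegral_iff_ofReal nv).1 hivΩ.2
  -- Finiteness for the cone is inherited from v through the comparison.
  have hiuΩ : IntegrableOn (mongeAmpere u) (puncturedBall ξ₀ R) volume :=
    ⟨mu, (hasFiniteIntegral_iff_ofReal nu).2 (hle.trans_lt hfin)⟩
  refine ⟨hiuΩ.congr_set_ae hae.symm, hiv, ?_⟩
  rw [← setIntegral_congr_set hae, ← setIntegral_congr_set hae,
    integral_eq_lintegral_of_nonneg_ae nu mu, integral_eq_lintegral_of_nonneg_ae nv hivΩ.1]
  exact ENNReal.toReal_mono hfin.ne hle
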